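/- Let $1/2<\alpha\le1$, $L,T>0$, $\Omega=(0,L)$; write $\|\cdot\|$ and $\langle\cdot,\cdot\rangle$ for the norm and inner product of $L_2(\Omega)$, $\|\cdot\|_1$ for the norm of $H^1(\Omega)$ and $|v|_2=\|v_{xx}\|$ (with $|v|_2=\infty$ if $v\notin H^2(\Omega)$). Put $\omega_\alpha(t)=t^{\alpha-1}/\Gamma(\alpha)$, $I^\alpha v(t)=\int_0^t\omega_\alpha(t-s)v(s)\,ds$ and $\partial_t^{1-\alpha}v=(I^\alpha v)_t$. Let $F\in L_\infty\bigl((0,T),W^1_\infty(\Omega)\bigr)\cap W^1_\infty\bigl((0,T),L_\infty(\Omega)\bigr)$, i.e. (for the continuous representative) there is $M$ with $|F(x,t)|\le M$, $|F(x,t)-F(y,t)|\le M|x-y|$ and $|F(x,t)-F(x,s)|\le M|t-s|$ for all $x,y\in\Omega$ and $s,t\in(0,T]$. Let $g\in L_1\bigl((0,T),L_2(\Omega)\bigr)$, $u_0\in H^1_0(\Omega)$, and let $u\in H^1\bigl((0,T),H^1_0(\Omega)\bigr)$, $u(0)=u_0$, be a weak solution of $u_t-\partial_t^{1-\alpha}u_{xx}+(F\partial_t^{1-\alpha}u)_x=g$,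 that is, for every $v\in H^1_0(\Omega)$ and almost every $t\in(0,T)$, $$\langle u_t,v\rangle+\langle\partial_t^{1-\alpha}u_x,v_x\rangle-\langle F\,\partial_t^{1-\alpha}u,v_x\rangle=\langle g(t),v\rangle .$$ Let $k=T/N$ with an integer $N\ge1$, $t_n=nk$, $I_n=(t_{n-1},t_n)$, $F^n=F(\cdot,t_n)$, let $\bar g^1,\dots,\bar g^N\in L_2(\Omega)$, and let $U^0=u_0$ and $U^1,\dots,U^N\in H^1_0(\Omega)$ satisfy the implicit scheme $$\langle U^n-U^{n-1},v\rangle+\int_{I_n}\Bigl(\langle\partial_t^{1-\alpha}\check U_x,v_x\rangle-\langle F^n\partial_t^{1-\alpha}\check U,v_x\rangle\Bigr)dt=k\,\langle\bar g^n,v\rangle\qquad(v\in H^1_0(\Omega),\ 1\le n\le N),$$ where $\check U(t)=U^n$ for $t\in I_n$. Then there are constants $C$ and $k_0>0$, depending only on $\alpha$, $T$ and $F$ (including its domain $\Omega\times(0,T)$), such that, whenever $k\le k_0$, for $0\le n\le N$, $$\|U^n-u(t_n)\|^2\le C\sum_{j=1}^n\int_{I_j}\|\bar g^j-g(t)\|^2\,dt+Ck^{2\alpha-1}\int_0^k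 t\,|u_t|_2^2\,dt+Ck^{2\alpha}\int_k^{t_n}|u_t|_2^2\,dt+Ck^2\|u_0\|_1^2+Ck^{2\alpha}\int_0^{t_n}\|u_t\|_1^2\,dt,$$ where the integral over $(k,t_n)$ is read as $0$ if $n=0$, and the right-hand side may be $+\infty$. Consequently, if in addition $\int_0^T|u_t|_2^2\,dt<\infty$, then for every $K$ there is a constant $C'$ (independent of $k$, $n$, $\bar g^j$ and $U^n$) such that, for $k\le k_0$, if $\|\bar g^j-g(t)\|\le Kk^\alpha$ for almost every $t\in I_j$ and $1\le j\le N$, then $\|U^n-u(t_n)\|\le C'k^\alpha$ for $0\le n\le N$. -/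

import Mathlib

open MeasureTheory Set
open scoped ENNReal NNReal ContDiff

namespace FracFP

noncomputable section

/-! ### Function spaces on the interval `Ω = (0, L)` -/

/-- The space `L₂(Ω)`, `Ω = (0, L)`. -/
abbrev L2 (L : ℝ) : Type := Lp ℝ 2 (volume.restrict (Ioo (0 : ℝ) L))

/-- Pairs of `L₂(Ω)`-functions with the Hilbert norm `‖(v, w)‖² = ‖v‖² + ‖w‖²`.  A function
`v ∈ H¹(Ω)` is represented by the pair `(v, vₓ)`, so that the norm of the pair is the usual norm
`‖v‖₁` of `H¹(Ω)`. -/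
abbrev Pair (L : ℝ) : Type := WithLp 2 (L2 L × L2 L)

/-- Test functions on `Ω`: smooth, with compact support contained in `(0, L)`. -/
def IsTest (L : ℝ) (φ : ℝ → ℝ) : Prop :=
  ContDiff ℝ ∞ φ ∧ HasCompactSupport φ ∧ tsupport φ ⊆ Ioo 0 L

/-- `w ∈ L₂(Ω)` is the weak derivative of `v ∈ L₂(Ω)`. -/
def HasWeakDeriv {L : ℝ} (v w : L2 L) : Prop :=
  ∀ φ : ℝ → ℝ, IsTest L φ →
    ∫ x in Ioo (0 : ℝ) L, v x * deriv φ x = - ∫ x in Ioo (0 : ℝ) L, w x * φ x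

/-- The Sobolev space `H¹₀(Ω)`: the closure of the test functions in the norm of `H¹(Ω)`. Its
elements are the pairs `(v, vₓ)`. -/
def H10 (L : ℝ) : Submodule ℝ (Pair L) :=
  (Submodule.span ℝ {p : Pair L | ∃ φ : ℝ → ℝ, IsTest L φ ∧
    p.fst =ᵐ[volume.restrict (Ioo (0 : ℝ) L)] φ ∧
    p.snd =ᵐ[volume.restrict (Ioo (0 : ℝ) L)] deriv φ}).topologicalClosure

/-- The seminorm `|v|₂ = ‖vₓₓ‖` of a function `v ∈ H¹(Ω)` given as `p = (v, vₓ)`.  The weak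
derivative of `vₓ` is unique if it exists, and `|v|₂ = ∞` if it does not exist, that is, if
`v ∉ H²(Ω)`. -/
def h2Seminorm {L : ℝ} (p : Pair L) : ℝ≥0∞ :=
  ⨅ (w : L2 L) (_ : HasWeakDeriv p.snd w), ‖w‖ₑ

/-! ### Fractional integral and derivative in time -/

/-- The kernel `ω_β(t) = t^(β-1) / Γ(β)`. -/
def omega (β t : ℝ) : ℝ := t ^ (β - 1) / Real.Gamma β

/-- The Riemann–Liouville fractional integral
`I^α v(t) = ∫₀ᵗ ω_α(t - s) v(s) ds` of a Hilbert-space-valued function. -/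
def fracInt {E : Type*} [NormedAddCommGroup E] [NormedSpace ℝ E] (α : ℝ) (v : ℝ → E) (t : ℝ) : E :=
  ∫ s in (0 : ℝ)..t, omega α (t - s) • v s

/-- The Riemann–Liouville fractional derivative `∂ₜ^(1-α) v = (I^α v)ₜ`. -/
def fracDeriv {E : Type*} [NormedAddCommGroup E] [NormedSpace ℝ E] (α : ℝ) (v : ℝ → E) (t : ℝ) :
    E :=
  deriv (fracInt α v) t

/-! ### The forcing -/

/-- `F ∈ L_∞((0,T), W¹_∞(Ω))`: the functions `F(·,t)` are bounded and Lipschitz continuous on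
`Ω`, uniformly in `t`. -/
def BddInW1Infty (L T : ℝ) (F : ℝ → ℝ → ℝ) : Prop :=
  ∃ M : ℝ, ∀ t ∈ Ioc (0 : ℝ) T,
    (∀ x ∈ Ioo (0 : ℝ) L, |F x t| ≤ M) ∧
    ∀ x ∈ Ioo (0 : ℝ) L, ∀ y ∈ Ioo (0 : ℝ) L, |F x t - F y t| ≤ M * |x - y|

/-- The remaining requirement in `F ∈ W¹_∞((0,T), L_∞(Ω))` for bounded `F`: Lipschitz continuity
in time with respect to the norm of `L_∞(Ω)`. -/
def LipschitzInTime (L T : ℝ) (F : ℝ → ℝ → ℝ) : Prop :=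
  ∃ M : ℝ, ∀ s ∈ Ioc (0 : ℝ) T, ∀ t ∈ Ioc (0 : ℝ) T, ∀ x ∈ Ioo (0 : ℝ) L,
    |F x t - F x s| ≤ M * |t - s|

/-! ### The Fokker–Planck equation and the time-stepping scheme -/

/-- The bilinear form `⟨pₓ, vₓ⟩ - ⟨f p, vₓ⟩`, for `p` and `v` in `H¹(Ω)`, and a bounded
function `f` on `Ω`. -/
def fpForm {L : ℝ} (f : ℝ → ℝ) (p v : Pair L) : ℝ :=
  inner ℝ p.snd v.snd - ∫ x in Ioo (0 : ℝ) L, f x * p.fst x * v.snd x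

/-- `u`, with time derivative `ut = uₜ`, is a weak solution of
`uₜ - ∂ₜ^(1-α) uₓₓ + (F ∂ₜ^(1-α) u)ₓ = g` in `(0,L) × (0,T)`, `u(0,t) = 0 = u(L,t)`,
`u(x,0) = u₀(x)`, such that `u ∈ H¹((0,T); H¹₀(Ω))` and `g ∈ L₁((0,T); L₂(Ω))`. -/
structure IsWeakSolution (α L T : ℝ) (F : ℝ → ℝ → ℝ) (g : ℝ → L2 L) (u₀ : Pair L)
    (u ut : ℝ → Pair L) : Prop where
  integrable_source : IntegrableOn g (Ioo 0 T)
  mem_H10 : ∀ t ∈ Icc 0 T, u t ∈ H10 L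
  memLp_deriv : MemLp ut 2 (volume.restrict (Ioo 0 T))
  eq_integral : ∀ t ∈ Icc 0 T, u t = u₀ + ∫ s in (0 : ℝ)..t, ut s
  equation : ∀ v ∈ H10 L, ∀ᵐ t ∂(volume.restrict (Ioo 0 T)),
    inner ℝ (ut t).fst v.fst + fpForm (fun x => F x t) (fracDeriv α u t) v =
      inner ℝ (g t) v.fst

/-- The piecewise constant function `Ǔ` with `Ǔ(t) = Uⁿ` for `(n-1)k < t ≤ nk`. -/
def check {E : Type*} (k : ℝ) (U : ℕ → E) (t : ℝ) : E := U ⌈t / k⌉₊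

/-- `U⁰, …, U^N` solve the implicit scheme with uniform step `k` and initial value `u₀`:
`Uⁿ - Uⁿ⁻¹ - ∫_{Iₙ} ∂ₜ^(1-α) Ǔₓₓ dt + ∫_{Iₙ} (Fⁿ ∂ₜ^(1-α) Ǔ)ₓ dt = k ḡⁿ` weakly, where
`Iₙ = ((n-1)k, nk)` and `Fⁿ = F(·,nk)`, with `Uⁿ(0) = 0 = Uⁿ(L)` for `1 ≤ n ≤ N`. -/
structure IsScheme (α L k : ℝ) (N : ℕ) (F : ℝ → ℝ → ℝ) (gbar : ℕ → L2 L) (u₀ : Pair L)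
    (U : ℕ → Pair L) : Prop where
  initial : U 0 = u₀
  mem_H10 : ∀ n ∈ Finset.Icc 1 N, U n ∈ H10 L
  equation : ∀ n ∈ Finset.Icc 1 N, ∀ v ∈ H10 L,
    inner ℝ (U n - U (n - 1)).fst v.fst +
      ∫ t in (((n : ℝ) - 1) * k)..((n : ℝ) * k),
        fpForm (fun x => F x ((n : ℝ) * k)) (fracDeriv α (check k U) t) v =
      k * inner ℝ (gbar n) v.fst

end

end FracFP

/-! Let `eⁿ = Uⁿ - u(tₙ)`, `xₙ = eⁿ⁺¹ - eⁿ`, and let `aₙ` be the integral of `ω_α` over `(nk,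
(n+1)k)`. Since `e⁰ = 0`, the integral of the fractional derivative of the step function of `e` over
the cell `(tₙ, tₙ₊₁)` is the discrete convolution `wₙ = (a * x)ₙ`. Subtracting the integrated weak
equation from the scheme and testing with `v = wₙ ∈ H¹₀` gives `2⟨xₙ, wₙ⟩ ≤ c‖wₙ‖² + dₙ`: the term
`‖wₙₓ‖²` absorbs every factor `wₙₓ`.

The defect `dₙ` has three sources. Replacing `u` by its step interpolant costs `(b * δ)ₙ`, where
`δⱼ` is the integral of `‖u_t‖₁` over a cell and `b` has total mass at most `2ω_{α+1}(k) = O(k^α)`.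
Freezing `F` at the end of the cell costs `Mk` times the integral of `‖∂_t^{1-α}u‖₁`, and
`∂_t^{1-α}u` is square integrable because `ω_α ∈ L₂(0,T)` for `α > 1/2`. The third source is `ḡ -
g`. Cauchy–Schwarz on the cells gives the sum of the `dₙ` a factor `k`.

Stability (`norm_sum_sq_le_of_inner_seqConv_le`) rests on Kaluza's theorem. The weights are
log-convex, so their convolution inverse `q` is nonpositive after its first term, whence `(q *
‖w‖²)ₙ ≤ 2⟨xₙ, wₙ⟩`, a discrete form of `∂^β‖w‖² ≤ 2⟨∂^β w, w⟩`. With `p = 1 * q`, which is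
nonnegative and satisfies `a * p = 1`, summation gives a fractional Gronwall inequality for `E = p *
‖w‖²`, solved with an exponential weight. Finally `eⁿ` is a `p`-weighted sum of the `wⱼ`, so
Cauchy–Schwarz bounds it by `E`; the factor lost is `O(1/k)`, which the factor `k` above
compensates. -/

/-! ### Discrete convolution kernels -/

namespace FracFP

section SeqConv

variable {V : Type*} [NormedAddCommGroup V] [InnerProductSpace ℝ V]

/-- The discrete convolution `(a * x)ₙ = ∑_{j ≤ n} a_{n-j} xⱼ`. -/
def seqConv (a : ℕ → ℝ) (x : ℕ → V) (n : ℕ) : V :=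
  ∑ j ∈ Finset.range (n + 1), a (n - j) • x j

lemma seqConv_comm (a b : ℕ → ℝ) : seqConv a b = seqConv b a := by
  funext n
  unfold seqConv
  rw [← Finset.sum_range_reflect]
  refine Finset.sum_congr rfl fun j hj => ?_
  have hj' : j ≤ n := Nat.lt_succ_iff.mp (Finset.mem_range.mp hj)
  have h1 : n + 1 - 1 - j = n - j := by omega
  have h2 : n - (n - j) = j := by omega
  rw [h1, h2, smul_eq_mul, smul_eq_mul, mul_comm]

lemma seqConv_assoc (a b : ℕ → ℝ) (x : ℕ → V) :
    seqConv a (seqConv b x) = seqConv (seqConv a b) x := by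
  funext n
  have h1 : seqConv a (seqConv b x) n = ∑ i ∈ Finset.range (n + 1), ∑ j ∈ Finset.Ico i (n + 1),
      (a (n - j) * b (j - i)) • x i := by
    unfold seqConv
    simp_rw [Finset.smul_sum, smul_smul]
    refine Finset.sum_comm' fun j i => ?_
    simp only [Finset.mem_range, Finset.mem_Ico]
    omega
  rw [h1]
  refine Finset.sum_congr rfl fun i hi => ?_
  have hi' : i ≤ n := Nat.lt_succ_iff.mp (Finset.mem_range.mp hi)
  rw [← Finset.sum_smul, Finset.sum_Ico_eq_sum_range]
  have h2 : n + 1 - i = n - i + 1 := by omega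
  rw [h2]
  congr 1
  refine Finset.sum_congr rfl fun j hj => ?_
  have hj' : j ≤ n - i := Nat.lt_succ_iff.mp (Finset.mem_range.mp hj)
  have h3 : n - (i + j) = n - i - j := by omega
  have h4 : i + j - i = j := by omega
  rw [h3, h4, smul_eq_mul]

lemma seqConv_one (x : ℕ → V) (n : ℕ) :
    seqConv (fun _ => 1) x n = ∑ j ∈ Finset.range (n + 1), x j := by
  simp [seqConv]

lemma seqConv_delta (x : ℕ → V) : seqConv (fun n => if n = 0 then 1 else 0) x = x := by
  funext n
  unfold seqConv
  rw [Finset.sum_range_succ, Finset.sum_eq_zero]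
  · simp
  · intro j hj
    have : n - j ≠ 0 := by have := Finset.mem_range.mp hj; omega
    simp [this]

/-! ### Kaluza's theorem, the discrete energy inequality and the fractional Gronwall inequality. -/

/-- Every sequence with `a₀ ≠ 0` has a convolution inverse. -/
lemma exists_seqConv_inverse (a : ℕ → ℝ) (ha : a 0 ≠ 0) :
    ∃ q : ℕ → ℝ, seqConv q a = fun n => if n = 0 then 1 else 0 := by
  refine ⟨fun n => PowerSeries.coeff n (PowerSeries.mk a)⁻¹, ?_⟩
  rw [seqConv_comm]
  funext n
  have h : (PowerSeries.mk a)⁻¹ * PowerSeries.mk a = 1 :=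
    PowerSeries.inv_mul_cancel _ (by simpa using ha)
  have h2 := congrArg (PowerSeries.coeff n) h
  rw [PowerSeries.coeff_mul, PowerSeries.coeff_one,
    Finset.Nat.sum_antidiagonal_eq_sum_range_succ_mk] at h2
  rw [← h2]
  refine Finset.sum_congr rfl fun j _ => ?_
  simp [mul_comm]

/-- **Kaluza's theorem**: the convolution inverse of a positive, log-convex sequence has
nonpositive coefficients, except for the first one. -/
lemma inverse_nonpos_of_logConvex {a q : ℕ → ℝ} (ha : ∀ n, 0 < a n)
    (hlog : ∀ n, a (n + 1) ^ 2 ≤ a n * a (n + 2))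
    (hq : seqConv q a = fun n => if n = 0 then 1 else 0) (n : ℕ) : q (n + 1) ≤ 0 := by
  have hr : Monotone fun n => a (n + 1) / a n := by
    refine monotone_nat_of_le_succ fun n => ?_
    rw [div_le_div_iff₀ (ha _) (ha _)]
    nlinarith [hlog n]
  rw [seqConv_comm] at hq
  have hq0 : a 0 * q 0 = 1 := by
    have := congrFun hq 0
    simpa [seqConv] using this
  have hq0' : 0 < q 0 := by
    by_contra h
    nlinarith [ha 0]
  have hqn : ∀ n, ∑ j ∈ Finset.range (n + 2), a (n + 1 - j) * q j = 0 := fun n => by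
    have := congrFun hq (n + 1)
    simpa [seqConv] using this
  induction n using Nat.strong_induction_on with
  | _ n ih =>
    have hn := hqn n
    rw [Finset.sum_range_succ, Nat.sub_self] at hn
    have key : 0 ≤ ∑ j ∈ Finset.range (n + 1), a (n + 1 - j) * q j := by
      rcases n with _ | n
      · simpa using (mul_pos (ha 1) hq0').le
      · have h1 := hqn n
        -- Subtracting `r` times the preceding convolution identity removes the `q 0` term. Since
        -- the ratios of `a` increase, the remaining coefficients are nonpositive, and so are the `q
        -- j` they multiply.
        set r := a (n + 2) / a (n + 1) with hrdef
        have h2 : ∑ j ∈ Finset.range (n + 2), a (n + 1 + 1 - j) * q j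
            = ∑ j ∈ Finset.range (n + 2), (a (n + 1 + 1 - j) - r * a (n + 1 - j)) * q j := by
          have : ∑ j ∈ Finset.range (n + 2), (a (n + 1 + 1 - j) - r * a (n + 1 - j)) * q j
              = ∑ j ∈ Finset.range (n + 2), a (n + 1 + 1 - j) * q j
                - r * ∑ j ∈ Finset.range (n + 2), a (n + 1 - j) * q j := by
            rw [Finset.mul_sum, ← Finset.sum_sub_distrib]
            exact Finset.sum_congr rfl fun j _ => by ring
          rw [this, h1]
          ring
        rw [h2]
        refine Finset.sum_nonneg fun j hj => ?_
        have hj' := Finset.mem_range.mp hj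
        rcases j with _ | j
        · have : a (n + 1 + 1 - 0) - r * a (n + 1 - 0) = 0 := by
            simp only [Nat.sub_zero, hrdef]
            rw [div_mul_cancel₀ _ (ha _).ne', sub_self]
          rw [this, zero_mul]
        · refine mul_nonneg_of_nonpos_of_nonpos ?_ (ih j (by omega))
          have h3 := hr (show n + 1 - (j + 1) ≤ n + 1 by omega)
          have h4 : n + 1 - (j + 1) + 1 = n + 1 + 1 - (j + 1) := by omega
          simp only [h4] at h3
          rw [div_le_iff₀ (ha _)] at h3
          linarith
    have h5 := ha 0
    by_contra h
    push Not at h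
    nlinarith

/-- Stability for convolution with a positive, decreasing, log-convex kernel: an energy inequality
combined with a fractional Gronwall inequality. -/
lemma norm_sum_sq_le_of_inner_seqConv_le {a : ℕ → ℝ} (ha : ∀ n, 0 < a n) (hanti : Antitone a)
    (hlog : ∀ n, a (n + 1) ^ 2 ≤ a n * a (n + 2)) (x : ℕ → V) {c ρ : ℝ} (hc : 0 ≤ c)
    (hρ : 0 < ρ) (hρ' : ρ ≤ 1) (d : ℕ → ℝ) (hd : ∀ n, 0 ≤ d n) (M : ℕ)
    (hsmall : c * ∑ i ∈ Finset.range (M + 1), a i * ρ ^ i ≤ 1 / 2)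
    (h : ∀ n ≤ M, 2 * inner ℝ (x n) (seqConv a x n) ≤ c * ‖seqConv a x n‖ ^ 2 + d n) :
    ‖∑ n ∈ Finset.range (M + 1), x n‖ ^ 2 ≤
      2 / (a M * ρ ^ M) * ∑ n ∈ Finset.range (M + 1), d n := by
  obtain ⟨q, hq⟩ := exists_seqConv_inverse a (ha 0).ne'
  have hqneg := inverse_nonpos_of_logConvex ha hlog hq
  set w := seqConv a x with hw
  have hxw : x = seqConv q w := by rw [hw, seqConv_assoc, hq, seqConv_delta]
  -- The partial sums of `q` form the kernel complementary to `a`, with `a * p = 1`.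
  set p := seqConv (fun _ => (1 : ℝ)) q with hp
  have hpa : seqConv p a = fun _ => 1 := by
    rw [hp, ← seqConv_assoc, hq, seqConv_comm, seqConv_delta]
  have hpn : ∀ n, p n = ∑ i ∈ Finset.range (n + 1), q i := fun n => by rw [hp, seqConv_one]
  -- Comparing `a * p = 1` at `n` and `n + 1`: since `a` decreases, the old terms lose mass, and the
  -- new term `a 0 * p (n + 1)` must make up for it.
  have hp0 : ∀ n, 0 ≤ p n := by
    have h1 : ∀ n, ∑ j ∈ Finset.range (n + 1), a (n - j) * p j = 1 := fun n => by
      have := congrFun ((seqConv_comm a p).trans hpa) n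
      simpa [seqConv] using this
    intro n
    induction n using Nat.strong_induction_on with
    | _ n ih =>
      rcases n with _ | n
      · have := h1 0
        simp only [zero_add, Finset.sum_range_one, Nat.sub_zero] at this
        by_contra hneg
        nlinarith [ha 0]
      · have h2 := h1 (n + 1)
        rw [Finset.sum_range_succ, ← h1 n, Nat.sub_self] at h2
        have h3 : ∑ j ∈ Finset.range (n + 1), a (n + 1 - j) * p j
            ≤ ∑ j ∈ Finset.range (n + 1), a (n - j) * p j := by
          refine Finset.sum_le_sum fun j hj => ?_
          have := Finset.mem_range.mp hj
          exact mul_le_mul_of_nonneg_right (hanti (by omega)) (ih j this)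
        by_contra hneg
        push Not at hneg
        nlinarith [ha 0]
  set y : ℕ → ℝ := fun n => ‖w n‖ ^ 2 with hy
  have hy0 : ∀ n, 0 ≤ y n := fun n => by positivity
  set E := seqConv p y with hE
  have hE0 : ∀ n, 0 ≤ E n := fun n =>
    Finset.sum_nonneg fun j _ => by
      rw [smul_eq_mul]
      exact mul_nonneg (hp0 _) (hy0 _)
  -- As `x = q * w` and the off-diagonal `q` are nonpositive, `2⟨wⱼ, wₙ⟩ ≤ ‖wⱼ‖² + ‖wₙ‖²` bounds the
  -- right side from below by `(q * y)ₙ + pₙ yₙ`.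
  have hqy : ∀ n, seqConv q y n ≤ 2 * inner ℝ (x n) (w n) := by
    intro n
    have h1 : inner ℝ (x n) (w n) =
        ∑ j ∈ Finset.range n, q (n - j) * inner ℝ (w j) (w n) + q 0 * y n := by
      conv_lhs => rw [hxw]
      unfold seqConv
      rw [sum_inner, Finset.sum_range_succ, Nat.sub_self, inner_smul_left]
      simp only [inner_smul_left, hy]
      rw [real_inner_self_eq_norm_sq]
      simp
    have h2 : seqConv q y n = ∑ j ∈ Finset.range n, q (n - j) * y j + q 0 * y n := by
      unfold seqConv
      rw [Finset.sum_range_succ, Nat.sub_self]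
      simp
    have h3 : ∑ j ∈ Finset.range n, q (n - j) * (y j + y n) ≤
        ∑ j ∈ Finset.range n, q (n - j) * (2 * inner ℝ (w j) (w n)) := by
      refine Finset.sum_le_sum fun j hj => ?_
      have hj' := Finset.mem_range.mp hj
      have h4 : q (n - j) ≤ 0 := by
        have := hqneg (n - j - 1)
        rwa [show n - j - 1 + 1 = n - j by omega] at this
      refine mul_le_mul_of_nonpos_left ?_ h4
      have := norm_sub_sq_real (w j) (w n)
      simp only [hy]
      nlinarith [sq_nonneg ‖w j - w n‖]
    have h5 : ∑ j ∈ Finset.range n, q (n - j) * y n + q 0 * y n = p n * y n := by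
      rw [hpn, ← Finset.sum_mul, ← add_mul, Finset.sum_range_succ' q n,
        ← Finset.sum_range_reflect (fun i => q (i + 1))]
      congr 2
      refine Finset.sum_congr rfl fun j hj => ?_
      have hj' := Finset.mem_range.mp hj
      congr 1
      omega
    have h6 : ∑ j ∈ Finset.range n, q (n - j) * (y j + y n) =
        ∑ j ∈ Finset.range n, q (n - j) * y j + ∑ j ∈ Finset.range n, q (n - j) * y n := by
      rw [← Finset.sum_add_distrib]
      exact Finset.sum_congr rfl fun j _ => by ring
    have h7 : ∑ j ∈ Finset.range n, q (n - j) * (2 * inner ℝ (w j) (w n)) =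
        2 * ∑ j ∈ Finset.range n, q (n - j) * inner ℝ (w j) (w n) := by
      rw [Finset.mul_sum]
      exact Finset.sum_congr rfl fun j _ => by ring
    have h8 := hp0 n
    have h9 : q 0 * y n ≥ 0 := by
      have : q 0 = p 0 := by rw [hpn]; simp
      rw [this]
      exact mul_nonneg (hp0 0) (hy0 n)
    have h10 := mul_nonneg h8 (hy0 n)
    rw [h1, h2]
    linarith
  have hEsum : ∀ m, E m = ∑ n ∈ Finset.range (m + 1), seqConv q y n := by
    intro m
    rw [← seqConv_one, seqConv_assoc]
  have haE : ∀ m, ∑ n ∈ Finset.range (m + 1), y n = seqConv a E m := by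
    intro m
    rw [hE, seqConv_assoc, seqConv_comm a p, hpa, seqConv_one]
  set S := ∑ n ∈ Finset.range (M + 1), d n with hS
  have hS0 : 0 ≤ S := Finset.sum_nonneg fun n _ => hd n
  -- Summing the energy inequality turns `q * y` into `E = p * y`, while the plain sum of `y` is `a
  -- * E`, because `a * p = 1`.
  have hEle : ∀ m ≤ M, E m ≤ c * seqConv a E m + S := by
    intro m hm
    rw [hEsum, ← haE, Finset.mul_sum]
    calc _ ≤ ∑ n ∈ Finset.range (m + 1), (c * y n + d n) := by
          refine Finset.sum_le_sum fun n hn => (hqy n).trans (h n ?_)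
          have := Finset.mem_range.mp hn
          omega
      _ ≤ _ := by
          rw [Finset.sum_add_distrib]
          gcongr
          exact Finset.sum_le_sum_of_subset_of_nonneg
            (Finset.range_mono (by omega)) fun n _ _ => hd n
  -- Gronwall by induction: in the weighted quantity `E m * ρ ^ m` the kernel becomes `a i * ρ ^ i`,
  -- whose mass times `c` is at most `1 / 2`.
  have hEbd : ∀ m ≤ M, E m * ρ ^ m ≤ 2 * S := by
    intro m
    induction m using Nat.strong_induction_on with
    | _ m ih =>
      intro hm
      have h1 := hEle m hm
      unfold seqConv at h1
      rw [Finset.sum_range_succ, Nat.sub_self] at h1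
      simp only [smul_eq_mul] at h1
      have h2 : (∑ j ∈ Finset.range m, a (m - j) * E j) * ρ ^ m ≤
          2 * S * ∑ j ∈ Finset.range m, a (m - j) * ρ ^ (m - j) := by
        rw [Finset.sum_mul, Finset.mul_sum]
        refine Finset.sum_le_sum fun j hj => ?_
        have hj' := Finset.mem_range.mp hj
        have h3 := ih j hj' (by omega)
        have h4 : ρ ^ m = ρ ^ j * ρ ^ (m - j) := by
          rw [← pow_add]
          congr 1
          omega
        have h5 : 0 ≤ a (m - j) * ρ ^ (m - j) := mul_nonneg (ha _).le (by positivity)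
        rw [h4]
        nlinarith
      have h6 : ∑ j ∈ Finset.range m, a (m - j) * ρ ^ (m - j) + a 0 =
          ∑ i ∈ Finset.range (m + 1), a i * ρ ^ i := by
        rw [Finset.sum_range_succ', ← Finset.sum_range_reflect (fun i => a (i + 1) * ρ ^ (i + 1))]
        simp only [pow_zero, mul_one, add_left_inj]
        refine Finset.sum_congr rfl fun j hj => ?_
        have hj' := Finset.mem_range.mp hj
        rw [show m - 1 - j + 1 = m - j by omega]
      have h7 : ∑ i ∈ Finset.range (m + 1), a i * ρ ^ i ≤
          ∑ i ∈ Finset.range (M + 1), a i * ρ ^ i :=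
        Finset.sum_le_sum_of_subset_of_nonneg (Finset.range_mono (by omega))
          fun i _ _ => mul_nonneg (ha _).le (by positivity)
      set Z := ∑ j ∈ Finset.range m, a (m - j) * ρ ^ (m - j) with hZ
      have hZ0 : 0 ≤ Z := Finset.sum_nonneg fun i _ => mul_nonneg (ha _).le (by positivity)
      have h8 : c * (Z + a 0) ≤ 1 / 2 := by
        rw [h6]
        exact (mul_le_mul_of_nonneg_left h7 hc).trans hsmall
      have hρm : 0 < ρ ^ m := by positivity
      have hρm1 : ρ ^ m ≤ 1 := pow_le_one₀ hρ.le hρ'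
      have h9 := mul_le_mul_of_nonneg_right h1 hρm.le
      have h10 := mul_le_mul_of_nonneg_left h2 hc
      have h11 : S * ρ ^ m ≤ S := by nlinarith
      have h12 : 0 ≤ c * Z := mul_nonneg hc hZ0
      have h13 : c * a 0 ≤ 1 / 2 := by nlinarith
      -- The implicit diagonal term is moved to the left. Here `Z + a 0` is the whole weighted mass,
      -- so `c * Z ≤ 1 / 2 - c * a 0`.
      have h14 : E m * ρ ^ m * (1 - c * a 0) ≤ 2 * S * (1 - c * a 0) := by
        nlinarith
      exact le_of_mul_le_mul_right h14 (by linarith)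
  have hsum : ∑ n ∈ Finset.range (M + 1), x n = ∑ j ∈ Finset.range (M + 1), p (M - j) • w j := by
    rw [← seqConv_one]
    conv_lhs => rw [hxw]
    rw [seqConv_assoc, ← hp]
    rfl
  -- Each weight in `(a * p) M = 1` is at least `a M`.
  have hpsum : a M * ∑ j ∈ Finset.range (M + 1), p (M - j) ≤ 1 := by
    have h1 := congrFun hpa M
    unfold seqConv at h1
    rw [← h1, Finset.mul_sum]
    refine Finset.sum_le_sum fun j hj => ?_
    have hj' := Finset.mem_range.mp hj
    rw [smul_eq_mul, mul_comm]
    exact mul_le_mul_of_nonneg_left (hanti (by omega)) (hp0 _)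
  have hcs : ‖∑ j ∈ Finset.range (M + 1), p (M - j) • w j‖ ^ 2 ≤
      (∑ j ∈ Finset.range (M + 1), p (M - j)) * E M := by
    have h1 : ‖∑ j ∈ Finset.range (M + 1), p (M - j) • w j‖ ≤
        ∑ j ∈ Finset.range (M + 1), p (M - j) * ‖w j‖ := by
      refine (norm_sum_le _ _).trans (Finset.sum_le_sum fun j _ => ?_)
      rw [norm_smul, Real.norm_of_nonneg (hp0 _)]
    refine (pow_le_pow_left₀ (norm_nonneg _) h1 2).trans ?_
    refine Finset.sum_sq_le_sum_mul_sum_of_sq_le_mul _ (fun j _ => hp0 _) (fun j _ => ?_)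
      (fun j _ => ?_)
    · rw [smul_eq_mul]
      exact mul_nonneg (hp0 _) (hy0 _)
    · simp only [hy, smul_eq_mul]
      exact le_of_eq (by ring)
  rw [hsum]
  have hEM := hEbd M le_rfl
  have hpos : 0 < a M * ρ ^ M := mul_pos (ha M) (by positivity)
  rw [div_mul_eq_mul_div, le_div_iff₀ hpos]
  set P := ∑ j ∈ Finset.range (M + 1), p (M - j) with hP
  have h2 := hE0 M
  have hρM : 0 < ρ ^ M := by positivity
  have haM := ha M
  calc _ ≤ P * E M * (a M * ρ ^ M) := mul_le_mul_of_nonneg_right hcs hpos.le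
    _ = (a M * P) * (E M * ρ ^ M) := by ring
    _ ≤ 1 * (E M * ρ ^ M) := mul_le_mul_of_nonneg_right hpsum (by positivity)
    _ ≤ _ := by linarith

/-- Young's inequality for discrete convolutions of nonnegative sequences. -/
lemma sum_seqConv_sq_le {b δ : ℕ → ℝ} (hb : ∀ n, 0 ≤ b n) (M : ℕ) :
    ∑ n ∈ Finset.range M, seqConv b δ n ^ 2 ≤
      (∑ i ∈ Finset.range M, b i) ^ 2 * ∑ j ∈ Finset.range M, δ j ^ 2 := by
  set B := ∑ i ∈ Finset.range M, b i with hB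
  have hB0 : 0 ≤ B := Finset.sum_nonneg fun i _ => hb i
  have h1 : ∀ n ∈ Finset.range M, seqConv b δ n ^ 2 ≤ B * seqConv b (fun j => δ j ^ 2) n := by
    intro n hn
    have hn' := Finset.mem_range.mp hn
    -- Cauchy–Schwarz with respect to the weights `b (n - j)`.
    have h2 : seqConv b δ n ^ 2 ≤ (∑ j ∈ Finset.range (n + 1), b (n - j)) *
        seqConv b (fun j => δ j ^ 2) n := by
      refine Finset.sum_sq_le_sum_mul_sum_of_sq_le_mul _ (fun j _ => hb _) (fun j _ => ?_)
        (fun j _ => ?_)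
      · exact mul_nonneg (hb _) (sq_nonneg _)
      · simp only [smul_eq_mul]
        exact le_of_eq (by ring)
    refine h2.trans (mul_le_mul_of_nonneg_right ?_ ?_)
    · have h3 := Finset.sum_range_reflect b (n + 1)
      simp only [Nat.add_sub_cancel] at h3
      rw [h3]
      exact Finset.sum_le_sum_of_subset_of_nonneg (Finset.range_mono (by omega))
        fun i _ _ => hb i
    · exact Finset.sum_nonneg fun j _ => mul_nonneg (hb _) (sq_nonneg _)
  refine (Finset.sum_le_sum h1).trans ?_
  rw [← Finset.mul_sum, sq, mul_assoc]
  refine mul_le_mul_of_nonneg_left ?_ hB0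
  have h4 : ∑ n ∈ Finset.range M, seqConv b (fun j => δ j ^ 2) n =
      ∑ j ∈ Finset.range M, ∑ n ∈ Finset.Ico j M, b (n - j) * δ j ^ 2 := by
    unfold seqConv
    refine Finset.sum_comm' fun n j => ?_
    simp only [Finset.mem_range, Finset.mem_Ico]
    omega
  rw [h4, Finset.mul_sum]
  refine Finset.sum_le_sum fun j _ => ?_
  rw [← Finset.sum_mul, Finset.sum_Ico_eq_sum_range]
  refine mul_le_mul_of_nonneg_right ?_ (sq_nonneg _)
  simp only [Nat.add_sub_cancel_left]
  exact Finset.sum_le_sum_of_subset_of_nonneg (Finset.range_mono (by omega)) fun i _ _ => hb i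

end SeqConv

end FracFP

/-! ### The kernel `ω_α` -/

namespace FracFP

lemma omega_nonneg {β t : ℝ} (hβ : 0 < β) (ht : 0 ≤ t) : 0 ≤ omega β t :=
  div_nonneg (Real.rpow_nonneg ht _) (Real.Gamma_pos_of_pos hβ).le

lemma omega_pos {β t : ℝ} (hβ : 0 < β) (ht : 0 < t) : 0 < omega β t :=
  div_pos (Real.rpow_pos_of_pos ht _) (Real.Gamma_pos_of_pos hβ)

lemma omega_anti {α s t : ℝ} (hα : 0 < α) (hα' : α ≤ 1) (hs : 0 < s) (hst : s ≤ t) :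
    omega α t ≤ omega α s :=
  div_le_div_of_nonneg_right (Real.rpow_le_rpow_of_nonpos hs hst (by linarith))
    (Real.Gamma_pos_of_pos hα).le

lemma intervalIntegrable_omega {α : ℝ} (hα : 0 < α) (a b : ℝ) :
    IntervalIntegrable (omega α) volume a b :=
  (intervalIntegral.intervalIntegrable_rpow' (by linarith)).div_const _

lemma integral_omega {α : ℝ} (hα : 0 < α) (a b : ℝ) :
    ∫ s in a..b, omega α s = omega (α + 1) b - omega (α + 1) a := by
  have h1 : Real.Gamma (α + 1) = α * Real.Gamma α := Real.Gamma_add_one hα.ne'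
  have h2 : Real.Gamma α ≠ 0 := (Real.Gamma_pos_of_pos hα).ne'
  simp only [omega]
  rw [intervalIntegral.integral_div, integral_rpow (Or.inl (by linarith)), h1]
  have h3 : α - 1 + 1 = α := by ring
  have h4 : α + 1 - 1 = α := by ring
  rw [h3, h4]
  field_simp

lemma omega_add_one_zero {α : ℝ} (hα : 0 < α) : omega (α + 1) 0 = 0 := by
  simp [omega, Real.zero_rpow hα.ne']

lemma measurable_omega (α : ℝ) : Measurable (omega α) := by
  unfold omega
  fun_prop

lemma hasDerivAt_omega_add_one {α t : ℝ} (hα : 0 < α) (ht : 0 < t) :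
    HasDerivAt (omega (α + 1)) (omega α t) t := by
  have h1 : Real.Gamma (α + 1) = α * Real.Gamma α := Real.Gamma_add_one hα.ne'
  have h2 : Real.Gamma α ≠ 0 := (Real.Gamma_pos_of_pos hα).ne'
  have h3 := (Real.hasDerivAt_rpow_const (x := t) (p := α) (Or.inl ht.ne')).div_const
    (Real.Gamma (α + 1))
  have h4 : omega (α + 1) = fun t => t ^ α / Real.Gamma (α + 1) := by
    funext t
    simp [omega]
  have h5 : omega α t = α * t ^ (α - 1) / Real.Gamma (α + 1) := by
    rw [h1, omega]
    field_simp
  rw [h4, h5]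
  exact h3

lemma continuous_omega_add_one {α : ℝ} (hα : 0 < α) : Continuous (omega (α + 1)) := by
  unfold omega
  refine Continuous.div_const ?_ _
  rw [add_sub_cancel_right]
  exact Real.continuous_rpow_const hα.le

/-! ### The step weights: positivity, monotonicity, log-convexity and exponentially weighted mass.
-/

/-- Weights of the Riemann–Liouville integral for functions that are constant on each step:
`aₙ = ∫ ω_α` over `(n k, (n + 1) k)`. -/
noncomputable def stepWeight (α k : ℝ) (n : ℕ) : ℝ := ∫ s in (0 : ℝ)..k, omega α (n * k + s)

lemma intervalIntegrable_omega_shift {α : ℝ} (hα : 0 < α) (c a b : ℝ) :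
    IntervalIntegrable (fun s => omega α (c + s)) volume a b := by
  have := (intervalIntegrable_omega hα (c + a) (c + b)).comp_add_left c
  simpa using this

lemma stepWeight_eq {α : ℝ} (hα : 0 < α) (k : ℝ) (n : ℕ) :
    stepWeight α k n = omega (α + 1) ((n + 1) * k) - omega (α + 1) (n * k) := by
  unfold stepWeight
  rw [intervalIntegral.integral_comp_add_left, integral_omega hα]
  congr 2
  · ring
  · ring

lemma stepWeight_zero {α : ℝ} (hα : 0 < α) (k : ℝ) :
    stepWeight α k 0 = omega (α + 1) k := by
  rw [stepWeight_eq hα]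
  simp [omega_add_one_zero hα]


lemma mul_omega_le_stepWeight {α k : ℝ} (hα : 0 < α) (hα' : α ≤ 1) (hk : 0 < k)
    (n : ℕ) : k * omega α ((n + 1) * k) ≤ stepWeight α k n := by
  have h : ∫ _ in (0 : ℝ)..k, omega α ((n + 1) * k) ≤ stepWeight α k n := by
    refine intervalIntegral.integral_mono_on_of_le_Ioo hk.le (by simp)
      (intervalIntegrable_omega_shift hα _ _ _) fun s hs => ?_
    have : 0 ≤ (n : ℝ) * k := by positivity
    refine omega_anti hα hα' (by linarith [hs.1]) ?_
    nlinarith [hs.2]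
  simpa using h

lemma stepWeight_pos {α k : ℝ} (hα : 0 < α) (hα' : α ≤ 1) (hk : 0 < k)
    (n : ℕ) : 0 < stepWeight α k n :=
  lt_of_lt_of_le (mul_pos hk (omega_pos hα (by positivity))) (mul_omega_le_stepWeight hα hα' hk n)

lemma stepWeight_antitone {α k : ℝ} (hα : 0 < α) (hα' : α ≤ 1) (hk : 0 < k) :
    Antitone (stepWeight α k) := by
  refine antitone_nat_of_succ_le fun n => ?_
  refine intervalIntegral.integral_mono_on_of_le_Ioo hk.le
      (intervalIntegrable_omega_shift hα _ _ _)
      (intervalIntegrable_omega_shift hα _ _ _) fun s hs => ?_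
  have : 0 ≤ (n : ℝ) * k := by positivity
  refine omega_anti hα hα' (by linarith [hs.1]) ?_
  push_cast
  nlinarith [hs.2]

/-- The kernel is log-convex pointwise, so the quadratic `ω(x)l² + 2ω(x+k)l + ω(x+2k)` is
nonnegative for all `l`. This survives integration over `x` in a cell, and the integrated quadratic
has nonpositive discriminant. -/
lemma stepWeight_logConvex {α k : ℝ} (hα : 0 < α) (hα' : α ≤ 1) (hk : 0 < k)
    (n : ℕ) :
    stepWeight α k (n + 1) ^ 2 ≤ stepWeight α k n * stepWeight α k (n + 2) := by
  have key : ∀ l : ℝ, 0 ≤ stepWeight α k n * (l * l) + (2 * stepWeight α k (n + 1)) * l +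
      stepWeight α k (n + 2) := by
    intro l
    have h1 : stepWeight α k n * (l * l) + (2 * stepWeight α k (n + 1)) * l +
      stepWeight α k (n + 2) = ∫ s in (0 : ℝ)..k, (omega α ((n : ℕ) * k + s) * (l * l) +
        omega α ((n + 1 : ℕ) * k + s) * (2 * l) + omega α ((n + 2 : ℕ) * k + s)) := by
      have i0 := intervalIntegrable_omega_shift hα ((n : ℕ) * k) 0 k
      have i1 := intervalIntegrable_omega_shift hα ((n + 1 : ℕ) * k) 0 k
      have i2 := intervalIntegrable_omega_shift hα ((n + 2 : ℕ) * k) 0 k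
      rw [intervalIntegral.integral_add ((i0.mul_const _).add (i1.mul_const _)) i2,
        intervalIntegral.integral_add (i0.mul_const _) (i1.mul_const _),
        intervalIntegral.integral_mul_const, intervalIntegral.integral_mul_const]
      simp only [stepWeight]
      ring
    rw [h1]
    refine intervalIntegral.integral_nonneg_of_ae_restrict hk.le ?_
    -- The point `s = 0` is discarded: for `n = 0` and `α < 1` the formal value `omega α 0 = 0`
    -- would break the pointwise inequality.
    filter_upwards [ae_restrict_of_ae (Measure.ae_ne volume (0 : ℝ)),
      ae_restrict_mem measurableSet_Icc] with s hs0 hs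
    have hs' : 0 < s := lt_of_le_of_ne hs.1 (Ne.symm hs0)
    have hn : 0 ≤ (n : ℝ) * k := by positivity
    set x := (n : ℝ) * k + s with hx
    have hx0 : 0 < x := by linarith
    have e1 : ((n + 1 : ℕ) : ℝ) * k + s = x + k := by push_cast; ring
    have e2 : ((n + 2 : ℕ) : ℝ) * k + s = x + 2 * k := by push_cast; ring
    simp only [Pi.zero_apply]
    rw [e1, e2]
    have p0 := omega_pos hα hx0
    have p1 := omega_pos hα (show 0 < x + k by linarith)
    have p2 := omega_pos hα (show 0 < x + 2 * k by linarith)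
    have h2 : omega α (x + k) ^ 2 ≤ omega α x * omega α (x + 2 * k) := by
      unfold omega
      rw [div_pow, div_mul_div_comm, ← sq, ← Real.mul_rpow hx0.le (by linarith),
        ← Real.rpow_natCast, ← Real.rpow_mul (by linarith), mul_comm, Real.rpow_mul (by linarith)]
      refine div_le_div_of_nonneg_right ?_ (sq_nonneg _)
      refine Real.rpow_le_rpow_of_nonpos (by positivity) ?_ (by linarith)
      rw [Real.rpow_natCast]
      nlinarith
    have h3 : 0 ≤ (omega α x * l + omega α (x + k)) ^ 2 := sq_nonneg _
    have h4 : 0 ≤ omega α x * (omega α x * (l * l) + omega α (x + k) * (2 * l) +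
        omega α (x + 2 * k)) := by nlinarith
    exact nonneg_of_mul_nonneg_right h4 p0
  have := discrim_le_zero key
  unfold discrim at this
  nlinarith

/-- On the cell `i` one has `exp(-μki) ≤ exp(μk) exp(-μs)`, so the sum is dominated by the Laplace
transform of `ω_α`, which is `μ^(-α)`. Its decay in `μ` is what makes the Gronwall kernel small. -/
lemma sum_stepWeight_mul_exp_le {α k : ℝ} (hα : 0 < α) (hk : 0 < k)
    {μ : ℝ} (hμ : 0 < μ) (m : ℕ) :
    ∑ i ∈ Finset.range m, stepWeight α k i * Real.exp (-(μ * k)) ^ i ≤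
      Real.exp (μ * k) * (1 / μ) ^ α := by
  have hint : IntegrableOn (fun s => omega α s * Real.exp (-(μ * s))) (Ioi 0) := by
    have h1 := Real.GammaIntegral_convergent hα
    have h2 := (integrableOn_Ioi_comp_mul_left_iff
      (fun x => Real.exp (-x) * x ^ (α - 1)) 0 hμ).mpr (by simpa using h1)
    have h3 := (h2.const_mul (μ ^ (α - 1))⁻¹).div_const (Real.Gamma α)
    refine IntegrableOn.congr_fun h3 (fun s hs => ?_) measurableSet_Ioi
    have hs' : 0 < s := hs
    have : μ ^ (α - 1) ≠ 0 := (Real.rpow_pos_of_pos hμ _).ne'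
    simp only [omega]
    rw [Real.mul_rpow hμ.le hs'.le]
    field_simp
  have hval : ∫ s in Ioi (0 : ℝ), omega α s * Real.exp (-(μ * s)) = (1 / μ) ^ α := by
    have h1 := Real.integral_rpow_mul_exp_neg_mul_Ioi hα hμ
    have h2 : Real.Gamma α ≠ 0 := (Real.Gamma_pos_of_pos hα).ne'
    have h3 : ∀ s : ℝ, omega α s * Real.exp (-(μ * s)) =
        s ^ (α - 1) * Real.exp (-(μ * s)) / Real.Gamma α := fun s => by
      unfold omega
      ring
    simp_rw [h3]
    rw [integral_div, h1]
    field_simp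
  have hii : ∀ a b : ℝ, 0 ≤ a → a ≤ b →
      IntervalIntegrable (fun s => omega α s * Real.exp (-(μ * s))) volume a b := by
    intro a b ha hab
    rw [intervalIntegrable_iff_integrableOn_Ioc_of_le hab]
    exact hint.mono_set fun s hs => lt_of_le_of_lt ha hs.1
  have hterm : ∀ i : ℕ, stepWeight α k i * Real.exp (-(μ * k)) ^ i ≤
      Real.exp (μ * k) * ∫ s in (i * k : ℝ)..((i + 1 : ℕ) * k : ℝ),
        omega α s * Real.exp (-(μ * s)) := by
    intro i
    have e1 : stepWeight α k i = ∫ s in (i * k : ℝ)..((i + 1 : ℕ) * k : ℝ), omega α s := by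
      rw [stepWeight_eq hα, integral_omega hα]
      push_cast
      rfl
    have hik : (i : ℝ) * k ≤ (i + 1 : ℕ) * k := by
      push_cast
      nlinarith
    have hik0 : 0 ≤ (i : ℝ) * k := by positivity
    rw [e1, ← intervalIntegral.integral_const_mul, ← intervalIntegral.integral_mul_const]
    refine intervalIntegral.integral_mono_on_of_le_Ioo hik
      ((intervalIntegrable_omega hα _ _).mul_const _) ((hii _ _ hik0 hik).const_mul _)
      fun s hs => ?_
    have hs0 : 0 < s := lt_of_le_of_lt hik0 hs.1
    have h1 := (omega_pos hα hs0).le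
    have h2 : Real.exp (-(μ * k)) ^ i ≤ Real.exp (μ * k) * Real.exp (-(μ * s)) := by
      rw [← Real.exp_nat_mul, ← Real.exp_add]
      refine Real.exp_le_exp.mpr ?_
      have := hs.2
      push_cast at this
      nlinarith
    nlinarith
  refine (Finset.sum_le_sum fun i _ => hterm i).trans ?_
  rw [← Finset.mul_sum]
  refine mul_le_mul_of_nonneg_left ?_ (Real.exp_pos _).le
  have hs := intervalIntegral.sum_integral_adjacent_intervals (n := m)
    (f := fun s => omega α s * Real.exp (-(μ * s))) (μ := volume) (a := fun i : ℕ => (i : ℝ) * k)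
    (fun i _ => hii _ _ (by positivity) (by push_cast; nlinarith))
  rw [hs, ← hval, intervalIntegral.integral_of_le
    (by simpa using (by positivity : 0 ≤ (m : ℝ) * k))]
  refine setIntegral_mono_set hint ?_ (Filter.Eventually.of_forall fun s hs => ?_)
  · filter_upwards [ae_restrict_mem measurableSet_Ioi] with s hs
    exact mul_nonneg (omega_pos hα hs).le (Real.exp_pos _).le
  · have h0 := hs.1
    exact lt_of_le_of_lt (by simp) h0

end FracFP

/-! ### Fractional integrals of step functions -/

namespace FracFP

lemma check_eq {E : Type*} {k : ℝ} (hk : 0 < k) (U : ℕ → E) {j : ℕ} {s : ℝ}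
    (hs : s ∈ Ioc ((j : ℝ) * k) ((j + 1 : ℕ) * k)) : check k U s = U (j + 1) := by
  unfold check
  congr 1
  rw [Nat.ceil_eq_iff (by omega)]
  refine ⟨?_, ?_⟩
  · rw [lt_div_iff₀ hk]
    simpa using hs.1
  · rw [div_le_iff₀ hk]
    exact hs.2

variable {E : Type*} [NormedAddCommGroup E] [NormedSpace ℝ E]

lemma intervalIntegrable_smul_const {f : ℝ → ℝ} {a b : ℝ}
    (hf : IntervalIntegrable f volume a b) (c : E) :
    IntervalIntegrable (fun s => f s • c) volume a b :=
  ⟨hf.1.smul_const c, hf.2.smul_const c⟩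

/-- The Riemann–Liouville integral of order `α` of the Heaviside function. -/
noncomputable def heavisideInt (α t : ℝ) : ℝ := omega (α + 1) (max t 0)

lemma intervalIntegrable_omega_sub {α : ℝ} (hα : 0 < α) (t a b : ℝ) :
    IntervalIntegrable (fun s => omega α (t - s)) volume a b := by
  have := (intervalIntegrable_omega hα (t - a) (t - b)).comp_sub_left t
  simpa using this

lemma integral_omega_sub {α : ℝ} (hα : 0 < α) (t a b : ℝ) :
    ∫ s in a..b, omega α (t - s) = omega (α + 1) (t - a) - omega (α + 1) (t - b) := by
  rw [intervalIntegral.integral_comp_sub_left (fun s => omega α s), integral_omega hα]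

/-- The grid is cut off at `t`, so the cells beyond `t` degenerate and the positive part in
`heavisideInt` appears. One formula then serves all `t` and can be differentiated in `t`. -/
lemma fracInt_check [CompleteSpace E] {α k : ℝ} (hα : 0 < α) (hk : 0 < k) (U : ℕ → E) (N : ℕ)
    {t : ℝ} (ht : t ∈ Icc 0 (N * k)) :
    fracInt α (check k U) t = ∑ j ∈ Finset.range N,
      (heavisideInt α (t - j * k) - heavisideInt α (t - (j + 1 : ℕ) * k)) • U (j + 1) := by
  set a : ℕ → ℝ := fun j => min (j * k) t with ha
  have ha0 : a 0 = 0 := by simp [ha, ht.1]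
  have haN : a N = t := by simp [ha, ht.2]
  have hmono : ∀ j, a j ≤ a (j + 1) := fun j => by
    refine min_le_min_right _ ?_
    push_cast
    nlinarith
  have hEq : ∀ j, EqOn (fun s => omega α (t - s) • check k U s)
      (fun s => omega α (t - s) • U (j + 1)) (Ioc (a j) (a (j + 1))) := by
    intro j s hs
    have h1 : s ∈ Ioc ((j : ℝ) * k) ((j + 1 : ℕ) * k) := by
      refine ⟨?_, hs.2.trans (min_le_left _ _)⟩
      rcases min_lt_iff.mp hs.1 with h | h
      · exact h
      · exact absurd (hs.2.trans (min_le_right _ _)) (not_le.mpr h)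
    simp only [check_eq hk U h1]
  have hint : ∀ j, IntervalIntegrable (fun s => omega α (t - s) • U (j + 1)) volume
      (a j) (a (j + 1)) := fun j =>
    intervalIntegrable_smul_const (intervalIntegrable_omega_sub hα t _ _) _
  unfold fracInt
  have h2 := intervalIntegral.sum_integral_adjacent_intervals (n := N) (a := a) (μ := volume)
    (f := fun s => omega α (t - s) • check k U s) (fun j _ => by
      refine (hint j).congr ?_
      rw [uIoc_of_le (hmono j)]
      exact (hEq j).symm)
  rw [ha0, haN] at h2
  rw [← h2]
  refine Finset.sum_congr rfl fun j _ => ?_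
  have h3 : ∀ i : ℕ, t - a i = max (t - i * k) 0 := fun i => by
    simp only [ha]
    rcases le_total ((i : ℝ) * k) t with h | h
    · rw [min_eq_left h, max_eq_left (by linarith)]
    · rw [min_eq_right h, max_eq_right (by linarith), sub_self]
  rw [intervalIntegral.integral_congr_ae (g := fun s => omega α (t - s) • U (j + 1))
    (Filter.Eventually.of_forall (by
      rw [uIoc_of_le (hmono j)]
      exact hEq j)), intervalIntegral.integral_smul_const, integral_omega_sub hα, h3, h3]
  rfl

lemma fracInt_check_grid [CompleteSpace E] {α k : ℝ} (hα : 0 < α) (hk : 0 < k) (U : ℕ → E)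
    (n : ℕ) :
    fracInt α (check k U) (n * k) =
      ∑ j ∈ Finset.range n, stepWeight α k (n - 1 - j) • U (j + 1) := by
  rw [fracInt_check hα hk U n ⟨by positivity, le_rfl⟩]
  refine Finset.sum_congr rfl fun j hj => ?_
  have hj' := Finset.mem_range.mp hj
  congr 1
  have e : ((n - 1 - j : ℕ) : ℝ) = n - 1 - j := by
    rw [Nat.cast_sub (by omega), Nat.cast_sub (by omega)]
    simp
  have hjn : (j : ℝ) + 1 ≤ n := by exact_mod_cast hj'
  rw [stepWeight_eq hα, e]
  unfold heavisideInt
  rw [max_eq_left (by nlinarith), max_eq_left (by push_cast; nlinarith)]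
  push_cast
  congr 2 <;> ring

lemma hasDerivAt_heavisideInt {α t : ℝ} (hα : 0 < α) (ht : t ≠ 0) :
    HasDerivAt (heavisideInt α) ((Ioi 0).indicator (omega α) t) t := by
  rcases lt_or_gt_of_ne ht with h | h
  · rw [indicator_of_notMem (by simpa using h.le)]
    refine (hasDerivAt_const t (0 : ℝ)).congr_of_eventuallyEq ?_
    filter_upwards [Iio_mem_nhds h] with s hs
    have hs' : s < 0 := hs
    rw [heavisideInt, max_eq_right hs'.le, omega_add_one_zero hα]
  · rw [indicator_of_mem (by exact h)]
    refine (hasDerivAt_omega_add_one hα h).congr_of_eventuallyEq ?_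
    filter_upwards [Ioi_mem_nhds h] with s hs
    have hs' : 0 < s := hs
    rw [heavisideInt, max_eq_left hs'.le]

lemma continuous_heavisideInt {α : ℝ} (hα : 0 < α) : Continuous (heavisideInt α) :=
  (continuous_omega_add_one hα).comp (continuous_id.max continuous_const)

lemma intervalIntegrable_indicator_omega_sub {α : ℝ} (hα : 0 < α) (c a b : ℝ) :
    IntervalIntegrable (fun t => (Ioi 0).indicator (omega α) (t - c)) volume a b := by
  have h1 : IntervalIntegrable ((Ioi (0 : ℝ)).indicator (omega α)) volume (a - c) (b - c) :=
    ⟨(intervalIntegrable_omega hα _ _).1.indicator measurableSet_Ioi,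
      (intervalIntegrable_omega hα _ _).2.indicator measurableSet_Ioi⟩
  simpa using h1.comp_sub_right c

/-- The fundamental theorem of calculus for the fractional derivative of a step function. -/
lemma fracDeriv_check [CompleteSpace E] {α k : ℝ} (hα : 0 < α) (hk : 0 < k) (U : ℕ → E) (n : ℕ) :
    IntervalIntegrable (fracDeriv α (check k U)) volume (n * k) ((n + 1 : ℕ) * k) ∧
    ∫ t in (n * k : ℝ)..((n + 1 : ℕ) * k), fracDeriv α (check k U) t =
      fracInt α (check k U) ((n + 1 : ℕ) * k) - fracInt α (check k U) (n * k) := by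
  -- Later values of `U` do not influence the fractional integral up to the end of the cell, so `n +
  -- 1` terms suffice. `S` is differentiable away from grid points, and `S'` has only integrable
  -- singularities.
  set S : ℝ → E := fun t => ∑ j ∈ Finset.range (n + 1),
      (heavisideInt α (t - j * k) - heavisideInt α (t - (j + 1 : ℕ) * k)) • U (j + 1) with hS
  set S' : ℝ → E := fun t => ∑ j ∈ Finset.range (n + 1),
      ((Ioi 0).indicator (omega α) (t - j * k) -
        (Ioi 0).indicator (omega α) (t - (j + 1 : ℕ) * k)) • U (j + 1) with hS'
  have hnk : (0 : ℝ) ≤ n * k := by positivity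
  have hlt : (n : ℝ) * k < (n + 1 : ℕ) * k := by
    push_cast
    nlinarith
  have hfS : ∀ t ∈ Icc (0 : ℝ) ((n + 1 : ℕ) * k), fracInt α (check k U) t = S t :=
    fun t ht => fracInt_check hα hk U (n + 1) ht
  have hder : ∀ t ∈ Ioo ((n : ℝ) * k) ((n + 1 : ℕ) * k), HasDerivAt S (S' t) t := by
    intro t ht
    have hne : ∀ j : ℕ, t - j * k ≠ 0 := by
      intro j hj
      have h1 : t = j * k := by linarith
      rw [h1] at ht
      have h2 := lt_of_mul_lt_mul_right ht.1 hk.le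
      have h3 := lt_of_mul_lt_mul_right ht.2 hk.le
      norm_cast at h2 h3
      omega
    have hd : ∀ j : ℕ, HasDerivAt (fun t => heavisideInt α (t - j * k))
        ((Ioi 0).indicator (omega α) (t - j * k)) t := fun j =>
      (hasDerivAt_heavisideInt hα (hne j)).comp_sub_const t _
    exact HasDerivAt.fun_sum fun j _ => ((hd j).sub (hd (j + 1))).smul_const _
  have hfd : ∀ t ∈ Ioo ((n : ℝ) * k) ((n + 1 : ℕ) * k), fracDeriv α (check k U) t = S' t := by
    intro t ht
    rw [← (hder t ht).deriv]
    refine Filter.EventuallyEq.deriv_eq ?_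
    filter_upwards [Ioo_mem_nhds ht.1 ht.2] with s hs
    exact hfS s ⟨hnk.trans hs.1.le, hs.2.le⟩
  have hcont : Continuous S := by
    refine continuous_finsetSum _ fun j _ => Continuous.smul (Continuous.sub ?_ ?_)
      continuous_const
    · exact (continuous_heavisideInt hα).comp (continuous_id.sub continuous_const)
    · exact (continuous_heavisideInt hα).comp (continuous_id.sub continuous_const)
  have hint : IntervalIntegrable S' volume (n * k) ((n + 1 : ℕ) * k) := by
    have h1 : ∀ j : ℕ, IntervalIntegrable (fun t => ((Ioi 0).indicator (omega α) (t - j * k) -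
        (Ioi 0).indicator (omega α) (t - (j + 1 : ℕ) * k)) • U (j + 1)) volume
        (n * k) ((n + 1 : ℕ) * k) := fun j =>
      intervalIntegrable_smul_const ((intervalIntegrable_indicator_omega_sub hα _ _ _).sub
        (intervalIntegrable_indicator_omega_sub hα _ _ _)) _
    have h2 := IntervalIntegrable.sum (Finset.range (n + 1)) (fun j _ => h1 j)
    simpa only [hS', Finset.sum_fn] using h2
  have hae : ∀ᵐ t, t ∈ uIoc ((n : ℝ) * k) ((n + 1 : ℕ) * k) →
      S' t = fracDeriv α (check k U) t := by
    rw [uIoc_of_le hlt.le]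
    filter_upwards [Measure.ae_ne volume (((n + 1 : ℕ) : ℝ) * k)] with t ht1 ht2
    exact (hfd t ⟨ht2.1, lt_of_le_of_ne ht2.2 ht1⟩).symm
  refine ⟨hint.congr_ae ((ae_restrict_iff' measurableSet_uIoc).mpr hae), ?_⟩
  rw [← intervalIntegral.integral_congr_ae hae,
    intervalIntegral.integral_eq_sub_of_hasDerivAt_of_le hlt.le hcont.continuousOn hder hint,
    hfS _ ⟨by positivity, le_rfl⟩, hfS _ ⟨hnk, hlt.le⟩]

end FracFP

/-! ### Fractional derivatives of absolutely continuous functions -/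

namespace FracFP

variable {E : Type*} [NormedAddCommGroup E] [NormedSpace ℝ E]

lemma fracInt_eq_integral_comp_sub (α : ℝ) (v : ℝ → E) (t : ℝ) :
    fracInt α v t = ∫ s in (0 : ℝ)..t, omega α s • v (t - s) := by
  have := intervalIntegral.integral_comp_sub_left (a := 0) (b := t)
    (fun s => omega α s • v (t - s)) t
  simpa [fracInt] using this

/-- The fractional derivative of a function with initial value `u₀` and derivative `w`. -/
noncomputable def fracDerivAC (α : ℝ) (u₀ : E) (w : ℝ → E) (t : ℝ) : E :=
  omega α t • u₀ + fracInt α w t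

open ContinuousLinearMap in
/-- `I^α w` is integrable, and `I¹ I^α w = I^α I¹ w`. -/
lemma integral_fracInt [CompleteSpace E] {α T : ℝ} (hα : 0 < α) {w : ℝ → E}
    (hw : IntervalIntegrable w volume 0 T) (hT : 0 ≤ T) :
    IntervalIntegrable (fracInt α w) volume 0 T ∧ ∀ t ∈ Icc 0 T,
      ∫ τ in (0 : ℝ)..t, fracInt α w τ = fracInt α (fun τ => ∫ s in (0 : ℝ)..τ, w s) t := by
  -- With kernel and function extended by zero, the fractional integral on `(0, T]` is a convolution
  -- of integrable functions on the line, and Fubini applies.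
  set κ : ℝ → ℝ := (Ioc 0 T).indicator (omega α) with hκ
  set f : ℝ → E := (Ioc 0 T).indicator w with hf
  have hκi : Integrable κ := by
    rw [hκ, integrable_indicator_iff measurableSet_Ioc]
    exact (intervalIntegrable_iff_integrableOn_Ioc_of_le hT).mp (intervalIntegrable_omega hα 0 T)
  have hfi : Integrable f := by
    rw [hf, integrable_indicator_iff measurableSet_Ioc]
    exact (intervalIntegrable_iff_integrableOn_Ioc_of_le hT).mp hw
  have hconv : ∀ τ ∈ Ioc 0 T, fracInt α w τ = ∫ s, κ s • f (τ - s) := by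
    intro τ hτ
    rw [fracInt_eq_integral_comp_sub, intervalIntegral.integral_of_le hτ.1.le,
      integral_Ioc_eq_integral_Ioo, ← integral_indicator measurableSet_Ioo]
    refine integral_congr_ae (Filter.Eventually.of_forall fun s => ?_)
    by_cases hs : s ∈ Ioo 0 τ
    · have h1 : s ∈ Ioc 0 T := ⟨hs.1, hs.2.le.trans hτ.2⟩
      have h2 : τ - s ∈ Ioc 0 T := ⟨sub_pos.mpr hs.2, by linarith [hs.1, hτ.2]⟩
      simp only [indicator_of_mem hs, hκ, hf, indicator_of_mem h1, indicator_of_mem h2]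
    · rw [indicator_of_notMem hs]
      by_cases hs0 : 0 < s
      · have h2 : τ - s ∉ Ioc 0 T := fun h => hs ⟨hs0, sub_pos.mp h.1⟩
        simp only [hf, indicator_of_notMem h2, smul_zero]
      · have h1 : s ∉ Ioc 0 T := fun h => hs0 h.1
        simp only [hκ, indicator_of_notMem h1, zero_smul]
  have hprod : Integrable (fun p : ℝ × ℝ => κ p.2 • f (p.1 - p.2)) (volume.prod volume) := by
    simpa using hκi.convolution_integrand (lsmul ℝ ℝ) hfi
  have hci : Integrable (fun τ => ∫ s, κ s • f (τ - s)) := hprod.integral_prod_left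
  refine ⟨?_, fun t ht => ?_⟩
  · rw [intervalIntegrable_iff_integrableOn_Ioc_of_le hT]
    exact hci.integrableOn.congr_fun (fun τ hτ => (hconv τ hτ).symm) measurableSet_Ioc
  · rw [intervalIntegral.integral_of_le ht.1, setIntegral_congr_fun measurableSet_Ioc
      (fun τ hτ => hconv τ ⟨hτ.1, hτ.2.trans ht.2⟩), integral_integral_swap]
    · rw [fracInt_eq_integral_comp_sub, intervalIntegral.integral_of_le ht.1,
        integral_Ioc_eq_integral_Ioo (x := 0) (y := t), ← integral_indicator measurableSet_Ioo]
      refine integral_congr_ae ?_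
      filter_upwards [Measure.ae_ne volume t] with s hst
      rw [integral_smul, ← intervalIntegral.integral_of_le ht.1,
        intervalIntegral.integral_comp_sub_right (fun x => f x), zero_sub]
      by_cases hs : s ∈ Ioo 0 t
      · have h1 : s ∈ Ioc 0 T := ⟨hs.1, hs.2.le.trans ht.2⟩
        rw [indicator_of_mem hs]
        simp only [hκ, indicator_of_mem h1]
        congr 1
        have hts : 0 ≤ t - s := sub_nonneg.mpr hs.2.le
        rw [intervalIntegral.integral_of_le (by linarith [ht.1]),
          intervalIntegral.integral_of_le hts, hf, setIntegral_indicator measurableSet_Ioc]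
        congr 2
        ext x
        simp only [mem_inter_iff, mem_Ioc]
        constructor
        · exact fun h => ⟨h.2.1, h.1.2⟩
        · exact fun h => ⟨⟨by linarith [h.1, hs.1], h.2⟩, h.1, by linarith [h.2, ht.2, hs.1]⟩
      · rw [indicator_of_notMem hs]
        by_cases hs0 : 0 < s
        · have hst' : t < s := lt_of_le_of_ne (not_lt.mp fun h => hs ⟨hs0, h⟩) (Ne.symm hst)
          rw [intervalIntegral.integral_of_le (by linarith [ht.1]), hf,
            setIntegral_indicator measurableSet_Ioc]
          have : Ioc (-s) (t - s) ∩ Ioc 0 T = ∅ := by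
            ext x
            simp only [mem_inter_iff, mem_Ioc, mem_empty_iff_false, iff_false]
            rintro ⟨⟨_, h2⟩, h3, _⟩
            linarith
          rw [this]
          simp
        · have h1 : s ∉ Ioc 0 T := fun h => hs0 h.1
          simp only [hκ, indicator_of_notMem h1, zero_smul]
    · have : (volume.restrict (Ioc 0 t)).prod (volume : Measure ℝ) =
          (volume.prod volume).restrict (Ioc 0 t ×ˢ univ) := by
        rw [← Measure.prod_restrict, Measure.restrict_univ]
      rw [this]
      exact hprod.integrableOn

lemma intervalIntegrable_fracDerivAC [CompleteSpace E] {α T : ℝ} (hα : 0 < α) (u₀ : E) {w : ℝ → E}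
    (hw : IntervalIntegrable w volume 0 T) (hT : 0 ≤ T) :
    IntervalIntegrable (fracDerivAC α u₀ w) volume 0 T :=
  (intervalIntegrable_smul_const (intervalIntegrable_omega hα 0 T) u₀).add
    (integral_fracInt hα hw hT).1

/-- Insert `u = u₀ + I¹w` and commute `I^α` with `I¹`: the fractional integral of `u` is the
primitive of `ω_α u₀ + I^α w`. -/
lemma fracInt_eq_integral_fracDerivAC [CompleteSpace E] {α T : ℝ} (hα : 0 < α) {u₀ : E}
    {u w : ℝ → E} (hw : IntervalIntegrable w volume 0 T) (hT : 0 ≤ T)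
    (hu : ∀ t ∈ Icc 0 T, u t = u₀ + ∫ s in (0 : ℝ)..t, w s) {t : ℝ} (ht : t ∈ Icc 0 T) :
    fracInt α u t = ∫ τ in (0 : ℝ)..t, fracDerivAC α u₀ w τ := by
  have hsub : uIcc 0 t ⊆ uIcc 0 T := by
    rw [uIcc_of_le ht.1, uIcc_of_le hT]
    exact Icc_subset_Icc_right ht.2
  have hI := integral_fracInt hα hw hT
  unfold fracDerivAC
  rw [intervalIntegral.integral_add (intervalIntegrable_smul_const
    (intervalIntegrable_omega hα 0 t) u₀) (hI.1.mono_set hsub), hI.2 t ht]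
  have hG : ContinuousOn (fun τ => ∫ s in (0 : ℝ)..τ, w s) (uIcc 0 t) :=
    (intervalIntegral.continuousOn_primitive_interval' hw left_mem_uIcc).mono hsub
  have h1 : fracInt α u t =
      ∫ s in (0 : ℝ)..t, (omega α (t - s) • u₀ + omega α (t - s) • ∫ r in (0 : ℝ)..s, w r) := by
    unfold fracInt
    refine intervalIntegral.integral_congr fun s hs => ?_
    rw [uIcc_of_le ht.1] at hs
    rw [hu s ⟨hs.1, hs.2.trans ht.2⟩, smul_add]
  rw [h1, intervalIntegral.integral_add
    (intervalIntegrable_smul_const (intervalIntegrable_omega_sub hα t 0 t) u₀)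
    ((intervalIntegrable_omega_sub hα t 0 t).smul_continuousOn hG),
    intervalIntegral.integral_smul_const, intervalIntegral.integral_smul_const]
  congr 2
  simp

/-- Lebesgue's differentiation theorem applied to the primitive; agreement almost everywhere is
enough for the weak equation. -/
lemma fracDeriv_ae_eq_fracDerivAC [CompleteSpace E] {α T : ℝ} (hα : 0 < α) {u₀ : E}
    {u w : ℝ → E} (hw : IntervalIntegrable w volume 0 T) (hT : 0 ≤ T)
    (hu : ∀ t ∈ Icc 0 T, u t = u₀ + ∫ s in (0 : ℝ)..t, w s) :
    ∀ᵐ t ∂(volume.restrict (Ioo 0 T)), fracDeriv α u t = fracDerivAC α u₀ w t := by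
  have h1 := (intervalIntegrable_fracDerivAC hα u₀ hw hT).ae_hasDerivAt_integral
  rw [ae_restrict_iff' measurableSet_Ioo]
  filter_upwards [h1] with t h2 ht
  have h3 := h2 (by rw [uIcc_of_le hT]; exact Ioo_subset_Icc_self ht) 0 left_mem_uIcc
  rw [← h3.deriv]
  refine Filter.EventuallyEq.deriv_eq ?_
  filter_upwards [Ioo_mem_nhds ht.1 ht.2] with s hs
  exact fracInt_eq_integral_fracDerivAC hα hw hT hu (Ioo_subset_Icc_self hs)

/-! ### Square integrability of the fractional derivative. -/

/-- The Cauchy–Schwarz inequality for integrals. -/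
lemma sq_integral_mul_le {f g : ℝ → ℝ} {a b : ℝ} (hab : a ≤ b)
    (hf : IntervalIntegrable (fun s => f s ^ 2) volume a b)
    (hg : IntervalIntegrable (fun s => g s ^ 2) volume a b)
    (hfg : IntervalIntegrable (fun s => f s * g s) volume a b) :
    (∫ s in a..b, f s * g s) ^ 2 ≤ (∫ s in a..b, f s ^ 2) * ∫ s in a..b, g s ^ 2 := by
  have key : ∀ l : ℝ, 0 ≤ (∫ s in a..b, f s ^ 2) * (l * l) +
      (2 * ∫ s in a..b, f s * g s) * l + ∫ s in a..b, g s ^ 2 := by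
    intro l
    have h1 : (∫ s in a..b, f s ^ 2) * (l * l) +
        (2 * ∫ s in a..b, f s * g s) * l + ∫ s in a..b, g s ^ 2 =
        ∫ s in a..b, (f s ^ 2 * (l * l) + f s * g s * (2 * l) + g s ^ 2) := by
      rw [intervalIntegral.integral_add ((hf.mul_const _).add (hfg.mul_const _)) hg,
        intervalIntegral.integral_add (hf.mul_const _) (hfg.mul_const _),
        intervalIntegral.integral_mul_const, intervalIntegral.integral_mul_const]
      ring
    rw [h1]
    refine intervalIntegral.integral_nonneg hab fun s _ => ?_
    nlinarith [sq_nonneg (f s * l + g s)]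
  have := discrim_le_zero key
  unfold discrim at this
  nlinarith

lemma sq_integral_norm_le {E : Type*} [NormedAddCommGroup E] {v : ℝ → E} {a b : ℝ} (hab : a ≤ b)
    (hv : IntervalIntegrable v volume a b)
    (hv2 : IntervalIntegrable (fun s => ‖v s‖ ^ 2) volume a b) :
    (∫ s in a..b, ‖v s‖) ^ 2 ≤ (b - a) * ∫ s in a..b, ‖v s‖ ^ 2 := by
  have := sq_integral_mul_le (f := fun _ => 1) (g := fun s => ‖v s‖) hab (by simp) hv2
    (by simpa using hv.norm)
  simpa using this

/-- The exponent `2α - 2` exceeds `-1` exactly when `α > 1/2`. -/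
lemma intervalIntegrable_omega_sq {α : ℝ} (hα : 1 / 2 < α) {t : ℝ} (ht : 0 ≤ t) :
    IntervalIntegrable (fun s => omega α s ^ 2) volume 0 t := by
  have h : IntervalIntegrable (fun s => s ^ (2 * α - 2) / Real.Gamma α ^ 2) volume 0 t :=
    (intervalIntegral.intervalIntegrable_rpow' (by linarith)).div_const _
  refine h.congr ?_
  rw [uIoc_of_le ht]
  intro s hs
  have e : s ^ (2 * α - 2) = (s ^ (α - 1)) ^ 2 := by
    rw [← Real.rpow_natCast, ← Real.rpow_mul hs.1.le]
    congr 1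
    push_cast
    ring
  simp only [omega, e, div_pow]

lemma norm_fracInt_sq_le {α : ℝ} (hα : 1 / 2 < α) {w : ℝ → E} {t : ℝ} (ht : 0 ≤ t)
    (hw : AEStronglyMeasurable w (volume.restrict (Ioc 0 t)))
    (hw2 : IntervalIntegrable (fun s => ‖w s‖ ^ 2) volume 0 t) :
    ‖fracInt α w t‖ ^ 2 ≤ (∫ s in (0 : ℝ)..t, omega α s ^ 2) * ∫ s in (0 : ℝ)..t, ‖w s‖ ^ 2 := by
  have hω : IntervalIntegrable (fun s => omega α (t - s) ^ 2) volume 0 t := by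
    have := ((intervalIntegrable_omega_sq hα ht).comp_sub_left t).symm
    simpa using this
  have hprod : IntervalIntegrable (fun s => omega α (t - s) * ‖w s‖) volume 0 t := by
    refine (hω.add hw2).mono_fun ?_ (Filter.Eventually.of_forall fun s => ?_)
    · rw [uIoc_of_le ht]
      exact ((measurable_omega α).comp (measurable_const.sub measurable_id)).aestronglyMeasurable.mul
        hw.norm
    · beta_reduce
      rw [Real.norm_eq_abs, Real.norm_eq_abs, abs_mul, abs_norm]
      refine le_trans ?_ (le_abs_self _)
      nlinarith [sq_nonneg (|omega α (t - s)| - ‖w s‖), sq_abs (omega α (t - s)),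
        sq_nonneg (omega α (t - s)), sq_nonneg ‖w s‖]
  have h1 : ‖fracInt α w t‖ ≤ ∫ s in (0 : ℝ)..t, omega α (t - s) * ‖w s‖ := by
    refine intervalIntegral.norm_integral_le_of_norm_le ht ?_ hprod
    refine Filter.Eventually.of_forall fun s hs => ?_
    rw [norm_smul, Real.norm_of_nonneg (omega_nonneg (by linarith) (by linarith [hs.2]))]
  have h2 : ∫ s in (0 : ℝ)..t, omega α (t - s) ^ 2 = ∫ s in (0 : ℝ)..t, omega α s ^ 2 := by
    simpa using intervalIntegral.integral_comp_sub_left (a := 0) (b := t)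
      (fun s => omega α s ^ 2) t
  refine (pow_le_pow_left₀ (norm_nonneg _) h1 2).trans ?_
  rw [← h2]
  exact sq_integral_mul_le ht hω hw2 hprod

/-- The `L₂`-bound for the fractional derivative of an absolutely continuous function. -/
lemma integral_norm_fracDerivAC_sq_le [CompleteSpace E] {α T : ℝ} (hα : 1 / 2 < α) (hT : 0 ≤ T)
    (u₀ : E) {w : ℝ → E} (hw : IntervalIntegrable w volume 0 T)
    (hw2 : IntervalIntegrable (fun s => ‖w s‖ ^ 2) volume 0 T) :
    IntervalIntegrable (fun t => ‖fracDerivAC α u₀ w t‖ ^ 2) volume 0 T ∧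
    ∀ t ∈ Icc 0 T, ∫ s in (0 : ℝ)..t, ‖fracDerivAC α u₀ w s‖ ^ 2 ≤
      2 * (∫ s in (0 : ℝ)..T, omega α s ^ 2) *
        (‖u₀‖ ^ 2 + T * ∫ s in (0 : ℝ)..t, ‖w s‖ ^ 2) := by
  have hα0 : 0 < α := by linarith
  set c := ∫ s in (0 : ℝ)..T, omega α s ^ 2 with hc
  have hsub : ∀ t ∈ Icc 0 T, uIcc 0 t ⊆ uIcc 0 T := fun t ht => by
    rw [uIcc_of_le ht.1, uIcc_of_le hT]
    exact Icc_subset_Icc_right ht.2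
  have hmono : ∀ f : ℝ → ℝ, (∀ s, 0 ≤ f s) → IntervalIntegrable f volume 0 T →
      ∀ s t, 0 ≤ s → s ≤ t → t ≤ T → ∫ r in (0 : ℝ)..s, f r ≤ ∫ r in (0 : ℝ)..t, f r := by
    intro f hf hfi s t hs hst ht
    exact intervalIntegral.integral_mono_interval le_rfl hs hst
      (Filter.Eventually.of_forall fun r => hf r) (hfi.mono_set (hsub t ⟨hs.trans hst, ht⟩))
  have hc0 : 0 ≤ c := intervalIntegral.integral_nonneg hT fun s _ => sq_nonneg _
  have hbd : ∀ t ∈ Icc 0 T, ∀ s ∈ Ioc 0 t, ‖fracDerivAC α u₀ w s‖ ^ 2 ≤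
      2 * ‖u₀‖ ^ 2 * omega α s ^ 2 + 2 * c * ∫ r in (0 : ℝ)..t, ‖w r‖ ^ 2 := by
    intro t ht s hs
    have hsT : s ∈ Icc 0 T := ⟨hs.1.le, hs.2.trans ht.2⟩
    have h1 := norm_fracInt_sq_le hα hs.1.le
      (hw.mono_set (hsub s hsT)).aestronglyMeasurable
      (hw2.mono_set (hsub s hsT))
    have h2 := hmono _ (fun r => sq_nonneg (omega α r)) (intervalIntegrable_omega_sq hα hT) s T
      hs.1.le hsT.2 le_rfl
    have h3 := hmono _ (fun r => sq_nonneg ‖w r‖) hw2 s t hs.1.le hs.2 ht.2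
    have h4 : 0 ≤ ∫ r in (0 : ℝ)..s, ‖w r‖ ^ 2 :=
      intervalIntegral.integral_nonneg hs.1.le fun r _ => sq_nonneg _
    have h5 : ‖fracInt α w s‖ ^ 2 ≤ c * ∫ r in (0 : ℝ)..t, ‖w r‖ ^ 2 :=
      h1.trans (mul_le_mul h2 h3 h4 hc0)
    have h6 : ‖fracDerivAC α u₀ w s‖ ≤ |omega α s| * ‖u₀‖ + ‖fracInt α w s‖ := by
      refine (norm_add_le _ _).trans ?_
      rw [norm_smul, Real.norm_eq_abs]
    have h7 := pow_le_pow_left₀ (norm_nonneg _) h6 2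
    have h8 := sq_abs (omega α s)
    nlinarith [sq_nonneg (|omega α s| * ‖u₀‖ - ‖fracInt α w s‖)]
  have hbi : ∀ t ∈ Icc 0 T, IntervalIntegrable (fun s => 2 * ‖u₀‖ ^ 2 * omega α s ^ 2 +
      2 * c * ∫ r in (0 : ℝ)..t, ‖w r‖ ^ 2) volume 0 t := fun t ht =>
    ((intervalIntegrable_omega_sq hα ht.1).const_mul _).add (by simp)
  have hDi : IntervalIntegrable (fun t => ‖fracDerivAC α u₀ w t‖ ^ 2) volume 0 T := by
    refine (hbi T ⟨hT, le_rfl⟩).mono_fun ?_ ?_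
    · have := (intervalIntegrable_fracDerivAC hα0 u₀ hw hT).aestronglyMeasurable
      rw [uIoc_of_le hT]
      exact this.norm.pow 2
    · rw [uIoc_of_le hT]
      filter_upwards [ae_restrict_mem measurableSet_Ioc] with s hs
      rw [Real.norm_of_nonneg (sq_nonneg _)]
      exact (hbd T ⟨hT, le_rfl⟩ s hs).trans (le_abs_self _)
  refine ⟨hDi, fun t ht => ?_⟩
  have h1 : ∫ s in (0 : ℝ)..t, ‖fracDerivAC α u₀ w s‖ ^ 2 ≤
      ∫ s in (0 : ℝ)..t, (2 * ‖u₀‖ ^ 2 * omega α s ^ 2 +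
        2 * c * ∫ r in (0 : ℝ)..t, ‖w r‖ ^ 2) :=
    intervalIntegral.integral_mono_on_of_le_Ioo ht.1 (hDi.mono_set (hsub t ht)) (hbi t ht)
      fun s hs => hbd t ht s ⟨hs.1, hs.2.le⟩
  refine h1.trans ?_
  rw [intervalIntegral.integral_add ((intervalIntegrable_omega_sq hα ht.1).const_mul _) (by simp),
    intervalIntegral.integral_const_mul, intervalIntegral.integral_const, sub_zero, smul_eq_mul]
  have h2 := hmono _ (fun r => sq_nonneg (omega α r)) (intervalIntegrable_omega_sq hα hT) t T
      ht.1 ht.2 le_rfl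
  have h3 : 0 ≤ ∫ r in (0 : ℝ)..t, ‖w r‖ ^ 2 :=
    intervalIntegral.integral_nonneg ht.1 fun r _ => sq_nonneg _
  have h4 : t * (2 * c * ∫ r in (0 : ℝ)..t, ‖w r‖ ^ 2) ≤
      T * (2 * c * ∫ r in (0 : ℝ)..t, ‖w r‖ ^ 2) :=
    mul_le_mul_of_nonneg_right ht.2 (by positivity)
  have h5 := mul_le_mul_of_nonneg_left h2 (show 0 ≤ 2 * ‖u₀‖ ^ 2 by positivity)
  rw [← hc] at h5
  linarith

/-! ### Interpolation by step functions -/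

/-- The absolute values of the coefficients of the discrete fractional derivative. -/
noncomputable def stepDiff (α k : ℝ) (n : ℕ) : ℝ :=
  if n = 0 then stepWeight α k 0 else stepWeight α k (n - 1) - stepWeight α k n

lemma stepDiff_nonneg {α k : ℝ} (hα : 0 < α) (hα' : α ≤ 1) (hk : 0 < k) (n : ℕ) :
    0 ≤ stepDiff α k n := by
  unfold stepDiff
  split_ifs
  · exact (stepWeight_pos hα hα' hk 0).le
  · exact sub_nonneg.mpr (stepWeight_antitone hα hα' hk (Nat.sub_le n 1))

/-- The differences telescope, leaving at most twice the first weight. Since `ω_{α+1}(k) = k^α /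
Γ(α+1)`, this is the origin of the order `k^α`. -/
lemma sum_stepDiff_le {α k : ℝ} (hα : 0 < α) (hα' : α ≤ 1) (hk : 0 < k) (n : ℕ) :
    ∑ i ∈ Finset.range n, stepDiff α k i ≤ 2 * omega (α + 1) k := by
  have h0 := stepWeight_pos hα hα' hk
  rw [← stepWeight_zero hα]
  rcases n with _ | n
  · simpa using (h0 0).le
  · rw [Finset.sum_range_succ']
    have : ∀ i, stepDiff α k (i + 1) = stepWeight α k i - stepWeight α k (i + 1) := fun i => by
      simp [stepDiff]
    simp_rw [this]
    rw [Finset.sum_range_sub']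
    simp only [stepDiff, if_true]
    linarith [h0 n]

/-- The increments of the fractional integral of the interpolation error `u - ǔ`. -/
lemma norm_fracInt_sub_check_le [CompleteSpace E] {α T k : ℝ} (hα : 0 < α) (hα' : α ≤ 1)
    (hk : 0 < k) {u₀ : E} {u w : ℝ → E} (hw : IntervalIntegrable w volume 0 T) (hT : 0 ≤ T)
    (hu : ∀ t ∈ Icc 0 T, u t = u₀ + ∫ s in (0 : ℝ)..t, w s) {n : ℕ}
    (hn : ((n + 1 : ℕ) : ℝ) * k ≤ T) :
    ‖(fracInt α u ((n + 1 : ℕ) * k) - fracInt α u (n * k)) -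
      (fracInt α (check k fun j => u (j * k)) ((n + 1 : ℕ) * k) -
        fracInt α (check k fun j => u (j * k)) (n * k))‖ ≤
      seqConv (stepDiff α k)
        (fun j => ∫ s in (j * k : ℝ)..((j + 1 : ℕ) * k), ‖w s‖) n := by
  set δ : ℕ → ℝ := fun j => ∫ s in (j * k : ℝ)..((j + 1 : ℕ) * k), ‖w s‖ with hδ
  set J : ℕ → ℕ → E := fun m j => ∫ s in (j * k : ℝ)..((j + 1 : ℕ) * k),
    omega α (m * k - s) • (u s - u ((j + 1 : ℕ) * k)) with hJ
  have hle : ∀ j : ℕ, (j : ℝ) * k ≤ (j + 1 : ℕ) * k := fun j => by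
    push_cast
    nlinarith
  have hgrid : ∀ j : ℕ, j ≤ n → Icc ((j : ℝ) * k) ((j + 1 : ℕ) * k) ⊆ Icc 0 T := by
    intro j hj s hs
    refine ⟨le_trans (by positivity) hs.1, hs.2.trans (le_trans ?_ hn)⟩
    have : ((j + 1 : ℕ) : ℝ) ≤ (n + 1 : ℕ) := by exact_mod_cast Nat.succ_le_succ hj
    exact mul_le_mul_of_nonneg_right this hk.le
  have hucont : ContinuousOn u (Icc 0 T) := by
    have h1 := intervalIntegral.continuousOn_primitive_interval' hw left_mem_uIcc
    rw [uIcc_of_le hT] at h1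
    exact (continuousOn_const.add h1).congr hu
  have hJint : ∀ (c : ℝ) (j : ℕ), j ≤ n → IntervalIntegrable
      (fun s => omega α (c - s) • (u s - u ((j + 1 : ℕ) * k))) volume
      (j * k) ((j + 1 : ℕ) * k) := by
    intro c j hj
    refine (intervalIntegrable_omega_sub hα c _ _).smul_continuousOn ?_
    rw [uIcc_of_le (hle j)]
    exact (hucont.mono (hgrid j hj)).sub continuousOn_const
  have hdiff : ∀ m ≤ n + 1, fracInt α u (m * k) - fracInt α (check k fun j => u (j * k)) (m * k) =
      ∑ j ∈ Finset.range m, J m j := by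
    intro m hm
    have hadj : ∀ v : ℝ → E, (∀ j < m, IntervalIntegrable (fun s => omega α (m * k - s) • v s) volume
        (j * k) ((j + 1 : ℕ) * k)) → fracInt α v (m * k) = ∑ j ∈ Finset.range m,
          ∫ s in (j * k : ℝ)..((j + 1 : ℕ) * k), omega α (m * k - s) • v s := by
      intro v hv
      have := intervalIntegral.sum_integral_adjacent_intervals (n := m) (μ := volume)
        (f := fun s => omega α (m * k - s) • v s) (a := fun j : ℕ => (j : ℝ) * k) hv
      rw [this]
      simp [fracInt]
    have hcheck : ∀ j : ℕ, EqOn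
        (fun s => omega α (m * k - s) • check k (fun j => u (j * k)) s)
        (fun s => omega α (m * k - s) • u ((j + 1 : ℕ) * k))
        (uIoc ((j : ℝ) * k) ((j + 1 : ℕ) * k)) := by
      intro j s hs
      rw [uIoc_of_le (hle j)] at hs
      simp only [check_eq hk _ hs]
    have hci : ∀ j : ℕ, IntervalIntegrable (fun s => omega α (m * k - s) • u ((j + 1 : ℕ) * k))
        volume (j * k) ((j + 1 : ℕ) * k) := fun j =>
      intervalIntegrable_smul_const (intervalIntegrable_omega_sub hα _ _ _) _
    have hui : ∀ j < m, IntervalIntegrable (fun s => omega α (m * k - s) • u s)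
        volume (j * k) ((j + 1 : ℕ) * k) := by
      intro j hj
      refine (intervalIntegrable_omega_sub hα _ _ _).smul_continuousOn ?_
      rw [uIcc_of_le (hle j)]
      exact hucont.mono (hgrid j (by omega))
    rw [hadj u hui, hadj _ fun j _ => (hci j).congr (hcheck j).symm, ← Finset.sum_sub_distrib]
    refine Finset.sum_congr rfl fun j hj => ?_
    rw [intervalIntegral.integral_congr_ae (Filter.Eventually.of_forall (hcheck j)),
      ← intervalIntegral.integral_sub (hui j (Finset.mem_range.mp hj)) (hci j)]
    simp only [hJ, smul_sub]
  have hdle : ∀ j ≤ n, ∀ s ∈ Icc ((j : ℝ) * k) ((j + 1 : ℕ) * k),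
      ‖u s - u ((j + 1 : ℕ) * k)‖ ≤ δ j := by
    intro j hj s hs
    have hend : ((j + 1 : ℕ) : ℝ) * k ∈ Icc 0 T := hgrid j hj ⟨hle j, le_rfl⟩
    have hsT := hgrid j hj hs
    have hsub : ∀ t ∈ Icc 0 T, ∀ t' ∈ Icc 0 T, IntervalIntegrable w volume t t' := by
      intro t ht t' ht'
      refine hw.mono_set (uIcc_subset_uIcc ?_ ?_)
      · rwa [uIcc_of_le hT]
      · rwa [uIcc_of_le hT]
    have hzero : (0 : ℝ) ∈ Icc 0 T := ⟨le_rfl, hT⟩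
    rw [norm_sub_rev, hu _ hend, hu _ hsT, add_sub_add_left_eq_sub,
      intervalIntegral.integral_interval_sub_left (hsub _ hzero _ hend) (hsub _ hzero _ hsT)]
    refine (intervalIntegral.norm_integral_le_integral_norm hs.2).trans ?_
    exact intervalIntegral.integral_mono_interval hs.1 hs.2 le_rfl
      (Filter.Eventually.of_forall fun r => norm_nonneg _)
      (hsub _ (hgrid j hj ⟨le_rfl, hle j⟩) _ hend).norm
  have hnormle : ∀ (φ : ℝ → ℝ) (j : ℕ), j ≤ n →
      IntervalIntegrable φ volume (j * k) ((j + 1 : ℕ) * k) →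
      (∀ s ∈ Ioo ((j : ℝ) * k) ((j + 1 : ℕ) * k), 0 ≤ φ s) →
      ‖∫ s in (j * k : ℝ)..((j + 1 : ℕ) * k), φ s • (u s - u ((j + 1 : ℕ) * k))‖ ≤
        (∫ s in (j * k : ℝ)..((j + 1 : ℕ) * k), φ s) * δ j := by
    intro φ j hj hφ hφ0
    rw [← intervalIntegral.integral_mul_const]
    refine intervalIntegral.norm_integral_le_of_norm_le (hle j) ?_ (hφ.mul_const _)
    filter_upwards [Measure.ae_ne volume (((j + 1 : ℕ) : ℝ) * k)] with s hs1 hs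
    have h0 := hφ0 s ⟨hs.1, lt_of_le_of_ne hs.2 hs1⟩
    rw [norm_smul, Real.norm_of_nonneg h0]
    exact mul_le_mul_of_nonneg_left (hdle j hj s (Ioc_subset_Icc_self hs)) h0
  have hweight : ∀ m j : ℕ, j < m → ∫ s in (j * k : ℝ)..((j + 1 : ℕ) * k), omega α (m * k - s) =
      stepWeight α k (m - 1 - j) := by
    intro m j hj
    have e : ((m - 1 - j : ℕ) : ℝ) = m - 1 - j := by
      rw [Nat.cast_sub (by omega), Nat.cast_sub (by omega)]
      simp
    rw [integral_omega_sub hα, stepWeight_eq hα, e]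
    push_cast
    congr 2 <;> ring
  -- On an earlier cell `j < n` only the change of the kernel acts, and it has one sign and mass
  -- `stepDiff α k (n - j)`. On the current cell the whole kernel acts, with mass `stepDiff α k 0`.
  -- The interpolation error on the cell is at most `δ j`.
  have hsplit : (fracInt α u ((n + 1 : ℕ) * k) - fracInt α u (n * k)) -
      (fracInt α (check k fun j => u (j * k)) ((n + 1 : ℕ) * k) -
        fracInt α (check k fun j => u (j * k)) (n * k)) =
      ∑ j ∈ Finset.range n, (J (n + 1) j - J n j) + J (n + 1) n := by
    have h1 := hdiff (n + 1) le_rfl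
    have h2 := hdiff n (Nat.le_succ n)
    rw [Finset.sum_sub_distrib, ← h2, sub_add_eq_add_sub, ← Finset.sum_range_succ, ← h1]
    abel
  rw [hsplit]
  unfold seqConv
  rw [Finset.sum_range_succ, Nat.sub_self]
  refine (norm_add_le _ _).trans (add_le_add ((norm_sum_le _ _).trans
    (Finset.sum_le_sum fun j hj => ?_)) ?_)
  · have hj' := Finset.mem_range.mp hj
    have e1 : J (n + 1) j - J n j = - ∫ s in (j * k : ℝ)..((j + 1 : ℕ) * k),
        (omega α (n * k - s) - omega α ((n + 1 : ℕ) * k - s)) • (u s - u ((j + 1 : ℕ) * k)) := by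
      simp only [hJ]
      rw [← intervalIntegral.integral_sub (hJint _ j hj'.le) (hJint _ j hj'.le),
        ← intervalIntegral.integral_neg]
      congr 1
      funext s
      rw [sub_smul, neg_sub]
    rw [e1, norm_neg]
    refine (hnormle _ j hj'.le ((intervalIntegrable_omega_sub hα _ _ _).sub
      (intervalIntegrable_omega_sub hα _ _ _)) fun s hs => ?_).trans ?_
    · refine sub_nonneg.mpr (omega_anti hα hα' ?_ ?_)
      · have h1 : ((j + 1 : ℕ) : ℝ) ≤ n := by exact_mod_cast hj'
        have h2 := mul_le_mul_of_nonneg_right h1 hk.le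
        linarith [hs.2]
      · push_cast
        linarith
    · rw [intervalIntegral.integral_sub (intervalIntegrable_omega_sub hα _ _ _)
        (intervalIntegrable_omega_sub hα _ _ _), hweight n j hj', hweight (n + 1) j (by omega)]
      have e2 : stepDiff α k (n - j) = stepWeight α k (n - 1 - j) -
          stepWeight α k (n + 1 - 1 - j) := by
        rw [stepDiff, if_neg (by omega)]
        congr 2
        omega
      rw [e2, smul_eq_mul]
  · refine (hnormle _ n le_rfl (intervalIntegrable_omega_sub hα _ _ _) fun s hs =>
      omega_nonneg hα (sub_nonneg.mpr hs.2.le)).trans ?_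
    rw [hweight (n + 1) n (by omega)]
    simp [stepDiff]

end FracFP

/-! ### The bilinear form -/

namespace FracFP

variable {L : ℝ}

lemma integrable_mul_mul_and_abs_integral_le {f : ℝ → ℝ} {M : ℝ}
    (hf : AEStronglyMeasurable f (volume.restrict (Ioo 0 L))) (hM : ∀ x ∈ Ioo 0 L, |f x| ≤ M)
    (p v : L2 L) :
    Integrable (fun x => f x * p x * v x) (volume.restrict (Ioo 0 L)) ∧
      |∫ x in Ioo (0 : ℝ) L, f x * p x * v x| ≤ M * ‖p‖ * ‖v‖ := by
  have hbd : ∀ᵐ x ∂(volume.restrict (Ioo (0 : ℝ) L)), ‖f x * p x‖ ≤ M * ‖p x‖ := by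
    filter_upwards [ae_restrict_mem measurableSet_Ioo] with x hx
    rw [norm_mul]
    exact mul_le_mul_of_nonneg_right (hM x hx) (norm_nonneg _)
  have hmem : MemLp (fun x => f x * p x) 2 (volume.restrict (Ioo 0 L)) :=
    (Lp.memLp p).of_le_mul (hf.mul (Lp.aestronglyMeasurable p)) hbd
  refine ⟨hmem.integrable_mul (Lp.memLp v), ?_⟩
  have h1 : ∫ x in Ioo (0 : ℝ) L, f x * p x * v x = inner ℝ v (hmem.toLp _) := by
    rw [L2.inner_def]
    refine integral_congr_ae ?_
    filter_upwards [hmem.coeFn_toLp] with x hx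
    rw [hx]
    simp
  have h2 : ‖hmem.toLp _‖ ≤ M * ‖p‖ := by
    refine Lp.norm_le_mul_norm_of_ae_le_mul ?_
    filter_upwards [hmem.coeFn_toLp, hbd] with x hx hx2
    rwa [hx]
  rw [h1]
  refine (abs_real_inner_le_norm _ _).trans ?_
  rw [mul_comm]
  exact mul_le_mul_of_nonneg_right h2 (norm_nonneg _)

lemma norm_fst_le (p : Pair L) : ‖p.fst‖ ≤ ‖p‖ := by
  have := WithLp.prod_norm_sq_eq_of_L2 p
  exact le_of_sq_le_sq (by nlinarith [sq_nonneg ‖p.snd‖]) (norm_nonneg _)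

lemma norm_snd_le (p : Pair L) : ‖p.snd‖ ≤ ‖p‖ := by
  have := WithLp.prod_norm_sq_eq_of_L2 p
  exact le_of_sq_le_sq (by nlinarith [sq_nonneg ‖p.fst‖]) (norm_nonneg _)

lemma abs_fpForm_le {f : ℝ → ℝ} {M : ℝ}
    (hf : AEStronglyMeasurable f (volume.restrict (Ioo 0 L))) (hM : ∀ x ∈ Ioo 0 L, |f x| ≤ M)
    (hM0 : 0 ≤ M) (p v : Pair L) : |fpForm f p v| ≤ (1 + M) * ‖p‖ * ‖v.snd‖ := by
  have h1 := (integrable_mul_mul_and_abs_integral_le hf hM p.fst v.snd).2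
  have h2 := abs_real_inner_le_norm p.snd v.snd
  have h3 := norm_fst_le p
  have h4 := norm_snd_le p
  unfold fpForm
  refine (abs_sub _ _).trans ?_
  have h5 : M * ‖p.fst‖ * ‖v.snd‖ ≤ M * ‖p‖ * ‖v.snd‖ := by gcongr
  have h6 : ‖p.snd‖ * ‖v.snd‖ ≤ ‖p‖ * ‖v.snd‖ := by gcongr
  linarith

/-- Continuity and linearity in the first argument allow the form with frozen forcing to pass
through Bochner integrals in time. -/
lemma exists_fpForm_clm {f : ℝ → ℝ} {M : ℝ}
    (hf : AEStronglyMeasurable f (volume.restrict (Ioo 0 L))) (hM : ∀ x ∈ Ioo 0 L, |f x| ≤ M)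
    (hM0 : 0 ≤ M) (v : Pair L) : ∃ A : Pair L →L[ℝ] ℝ, ∀ p, A p = fpForm f p v := by
  have hi := fun p : L2 L => (integrable_mul_mul_and_abs_integral_le hf hM p v.snd).1
  let A : Pair L →ₗ[ℝ] ℝ :=
    { toFun := fun p => fpForm f p v
      map_add' := fun p q => by
        have h1 : ∫ x in Ioo (0 : ℝ) L, f x * (p + q).fst x * v.snd x =
            ∫ x in Ioo (0 : ℝ) L, (f x * p.fst x * v.snd x + f x * q.fst x * v.snd x) := by
          refine integral_congr_ae ?_
          filter_upwards [Lp.coeFn_add p.fst q.fst] with x hx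
          rw [WithLp.add_fst, hx, Pi.add_apply]
          ring
        unfold fpForm
        rw [h1, integral_add (hi _) (hi _), WithLp.add_snd, inner_add_left]
        ring
      map_smul' := fun c p => by
        have h1 : ∫ x in Ioo (0 : ℝ) L, f x * (c • p).fst x * v.snd x =
            ∫ x in Ioo (0 : ℝ) L, c * (f x * p.fst x * v.snd x) := by
          refine integral_congr_ae ?_
          filter_upwards [Lp.coeFn_smul c p.fst] with x hx
          rw [WithLp.smul_fst, hx, Pi.smul_apply, smul_eq_mul]
          ring
        unfold fpForm
        rw [h1, integral_const_mul, WithLp.smul_snd, real_inner_smul_left, RingHom.id_apply,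
          smul_eq_mul]
        ring }
  refine ⟨A.mkContinuous ((1 + M) * ‖v.snd‖) fun p => ?_, fun p => rfl⟩
  rw [Real.norm_eq_abs]
  refine (abs_fpForm_le hf hM hM0 p v).trans (le_of_eq ?_)
  ring

lemma abs_fpForm_sub_le {f f' : ℝ → ℝ} {M M' : ℝ}
    (hf : AEStronglyMeasurable f (volume.restrict (Ioo 0 L))) (hM : ∀ x ∈ Ioo 0 L, |f x| ≤ M)
    (hf' : AEStronglyMeasurable f' (volume.restrict (Ioo 0 L))) (hM' : ∀ x ∈ Ioo 0 L, |f' x| ≤ M)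
    (hd : ∀ x ∈ Ioo 0 L, |f' x - f x| ≤ M') (hM0 : 0 ≤ M') (p v : Pair L) :
    |fpForm f p v - fpForm f' p v| ≤ M' * ‖p‖ * ‖v.snd‖ := by
  have h1 := (integrable_mul_mul_and_abs_integral_le hf hM p.fst v.snd).1
  have h2 := (integrable_mul_mul_and_abs_integral_le hf' hM' p.fst v.snd).1
  have h3 := (integrable_mul_mul_and_abs_integral_le (hf'.sub hf) hd p.fst v.snd).2
  have h4 : fpForm f p v - fpForm f' p v =
      ∫ x in Ioo (0 : ℝ) L, (f' - f) x * p.fst x * v.snd x := by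
    have : ∀ x, (f' - f) x * p.fst x * v.snd x =
        f' x * p.fst x * v.snd x - f x * p.fst x * v.snd x := fun x => by
      rw [Pi.sub_apply]
      ring
    simp_rw [this]
    rw [integral_sub h2 h1]
    unfold fpForm
    ring
  rw [h4]
  refine h3.trans ?_
  have := norm_fst_le p
  gcongr

/-- A Gårding-type bound: the form is coercive in `pₓ` up to a lower-order term. -/
lemma le_fpForm_self {f : ℝ → ℝ} {M : ℝ}
    (hf : AEStronglyMeasurable f (volume.restrict (Ioo 0 L))) (hM : ∀ x ∈ Ioo 0 L, |f x| ≤ M)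
    (p : Pair L) : ‖p.snd‖ ^ 2 - M * ‖p.fst‖ * ‖p.snd‖ ≤ fpForm f p p := by
  have h1 := (integrable_mul_mul_and_abs_integral_le hf hM p.fst p.snd).2
  have h2 := (abs_le.mp h1).2
  unfold fpForm
  rw [real_inner_self_eq_norm_sq]
  linarith

/-- Uniform bounds for the forcing. -/
def ForcingBound (L T M : ℝ) (F : ℝ → ℝ → ℝ) : Prop :=
  0 ≤ M ∧ (∀ t ∈ Ioc 0 T, AEStronglyMeasurable (fun x => F x t) (volume.restrict (Ioo 0 L))) ∧
    (∀ t ∈ Ioc 0 T, ∀ x ∈ Ioo 0 L, |F x t| ≤ M) ∧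
    ∀ s ∈ Ioc 0 T, ∀ t ∈ Ioc 0 T, ∀ x ∈ Ioo 0 L, |F x t - F x s| ≤ M * |t - s|

lemma exists_forcingBound {T : ℝ} {F : ℝ → ℝ → ℝ} (hF : BddInW1Infty L T F)
    (hFt : LipschitzInTime L T F) : ∃ M, ForcingBound L T M F := by
  obtain ⟨M₁, h1⟩ := hF
  obtain ⟨M₂, h2⟩ := hFt
  refine ⟨max (max M₁ M₂) 0, le_max_right _ _, fun t ht => ?_, fun t ht x hx => ?_,
    fun s hs t ht x hx => ?_⟩
  · have hL : LipschitzOnWith (Real.toNNReal M₁) (fun x => F x t) (Ioo 0 L) := by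
      refine LipschitzOnWith.of_dist_le_mul fun x hx y hy => ?_
      rw [Real.dist_eq, Real.dist_eq]
      refine ((h1 t ht).2 x hx y hy).trans ?_
      exact mul_le_mul_of_nonneg_right (Real.le_coe_toNNReal _) (abs_nonneg _)
    exact hL.continuousOn.aestronglyMeasurable measurableSet_Ioo
  · exact ((h1 t ht).1 x hx).trans ((le_max_left _ _).trans (le_max_left _ _))
  · refine (h2 s hs t ht x hx).trans ?_
    exact mul_le_mul_of_nonneg_right ((le_max_right _ _).trans (le_max_left _ _)) (abs_nonneg _)

/-! ### The error equation -/

namespace IsWeakSolution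

variable {α T : ℝ} {F : ℝ → ℝ → ℝ} {g : ℝ → L2 L} {u₀ : Pair L} {u ut : ℝ → Pair L}

lemma intervalIntegrable_deriv (h : IsWeakSolution α L T F g u₀ u ut) (hT : 0 ≤ T) :
    IntervalIntegrable ut volume 0 T := by
  rw [intervalIntegrable_iff_integrableOn_Ioo_of_le hT]
  exact h.memLp_deriv.integrable one_le_two

lemma intervalIntegrable_deriv_sq (h : IsWeakSolution α L T F g u₀ u ut) (hT : 0 ≤ T) :
    IntervalIntegrable (fun t => ‖ut t‖ ^ 2) volume 0 T := by
  rw [intervalIntegrable_iff_integrableOn_Ioo_of_le hT]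
  exact MemLp.integrable_norm_pow (p := 2) (by exact_mod_cast h.memLp_deriv) two_ne_zero

lemma intervalIntegrable_source (h : IsWeakSolution α L T F g u₀ u ut) (hT : 0 ≤ T) :
    IntervalIntegrable g volume 0 T := by
  rw [intervalIntegrable_iff_integrableOn_Ioo_of_le hT]
  exact h.integrable_source

/-- The weak equation, integrated over `(a, b)`, with the forcing frozen at time `b`. -/
lemma abs_integral_equation_le (h : IsWeakSolution α L T F g u₀ u ut) (hα : 0 < α) {M : ℝ}
    (hF : ForcingBound L T M F) {a b : ℝ} (ha : 0 ≤ a) (hab : a < b) (hb : b ≤ T) {v : Pair L}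
    (hv : v ∈ H10 L) :
    |inner ℝ (u b - u a).fst v.fst +
      fpForm (fun x => F x b) (fracInt α u b - fracInt α u a) v -
      ∫ t in a..b, inner ℝ (g t) v.fst| ≤
      M * (b - a) * (∫ t in a..b, ‖fracDerivAC α u₀ ut t‖) * ‖v.snd‖ := by
  obtain ⟨hM0, hFm, hFM, hFL⟩ := hF
  have hT : 0 ≤ T := (ha.trans hab.le).trans hb
  have hbT : b ∈ Ioc 0 T := ⟨lt_of_le_of_lt ha hab, hb⟩
  have hsub : uIcc a b ⊆ uIcc 0 T := by
    rw [uIcc_of_le hab.le, uIcc_of_le hT]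
    exact Icc_subset_Icc ha hb
  have hsub0 : ∀ t ∈ Icc 0 T, uIcc 0 t ⊆ uIcc 0 T := fun t ht => by
    rw [uIcc_of_le ht.1, uIcc_of_le hT]
    exact Icc_subset_Icc_right ht.2
  have haI : a ∈ Icc 0 T := ⟨ha, hab.le.trans hb⟩
  have hbI : b ∈ Icc 0 T := ⟨hbT.1.le, hb⟩
  have hut := h.intervalIntegrable_deriv hT
  have hD := intervalIntegrable_fracDerivAC hα u₀ hut hT
  have hDab := hD.mono_set hsub
  have hutab := hut.mono_set hsub
  have hgab := (h.intervalIntegrable_source hT).mono_set hsub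
  set D := fracDerivAC α u₀ ut with hDdef
  have hfr : fracInt α u b - fracInt α u a = ∫ t in a..b, D t := by
    rw [fracInt_eq_integral_fracDerivAC hα hut hT h.eq_integral hbI,
      fracInt_eq_integral_fracDerivAC hα hut hT h.eq_integral haI,
      intervalIntegral.integral_interval_sub_left (hD.mono_set (hsub0 b hbI))
        (hD.mono_set (hsub0 a haI))]
  have hdu : u b - u a = ∫ t in a..b, ut t := by
    rw [h.eq_integral b hbI, h.eq_integral a haI, add_sub_add_left_eq_sub,
      intervalIntegral.integral_interval_sub_left (hut.mono_set (hsub0 b hbI))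
        (hut.mono_set (hsub0 a haI))]
  obtain ⟨A, hA⟩ := exists_fpForm_clm (hFm b hbT) (hFM b hbT) hM0 v
  set B : Pair L →L[ℝ] ℝ := (innerSL ℝ v.fst).comp (WithLp.fstL 2 ℝ (L2 L) (L2 L)) with hB
  have hBapp : ∀ p : Pair L, B p = inner ℝ p.fst v.fst := fun p => by
    rw [real_inner_comm]
    rfl
  set G : L2 L →L[ℝ] ℝ := innerSL ℝ v.fst with hG
  have hGapp : ∀ p : L2 L, G p = inner ℝ p v.fst := fun p => by
    rw [real_inner_comm]
    rfl
  have iB : IntervalIntegrable (fun t => B (ut t)) volume a b :=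
    ⟨B.integrable_comp hutab.1, B.integrable_comp hutab.2⟩
  have iA : IntervalIntegrable (fun t => A (D t)) volume a b :=
    ⟨A.integrable_comp hDab.1, A.integrable_comp hDab.2⟩
  have iG : IntervalIntegrable (fun t => G (g t)) volume a b :=
    ⟨G.integrable_comp hgab.1, G.integrable_comp hgab.2⟩
  have hae : ∀ᵐ t, t ∈ Ioc a b →
      B (ut t) + fpForm (fun x => F x t) (D t) v = G (g t) := by
    have h1 := h.equation v hv
    have h2 := fracDeriv_ae_eq_fracDerivAC hα hut hT h.eq_integral
    rw [ae_restrict_iff' measurableSet_Ioo] at h1 h2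
    filter_upwards [h1, h2, Measure.ae_ne volume b] with t ht1 ht2 htb ht
    have htT : t ∈ Ioo 0 T := ⟨lt_of_le_of_lt ha ht.1,
      lt_of_lt_of_le (lt_of_le_of_ne ht.2 htb) hb⟩
    rw [hBapp, hGapp, hDdef, ← ht2 htT]
    exact ht1 htT
  have e1 : inner ℝ (u b - u a).fst v.fst = ∫ t in a..b, B (ut t) := by
    rw [← hBapp, hdu, ContinuousLinearMap.intervalIntegral_comp_comm B hutab]
  have e2 : fpForm (fun x => F x b) (fracInt α u b - fracInt α u a) v = ∫ t in a..b, A (D t) := by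
    rw [← hA, hfr, ContinuousLinearMap.intervalIntegral_comp_comm A hDab]
  have e3 : ∫ t in a..b, inner ℝ (g t) v.fst = ∫ t in a..b, G (g t) := by
    simp_rw [hGapp]
  rw [e1, e2, e3, ← intervalIntegral.integral_add iB iA,
    ← intervalIntegral.integral_sub (iB.add iA) iG, ← Real.norm_eq_abs]
  have hR : M * (b - a) * (∫ t in a..b, ‖D t‖) * ‖v.snd‖ =
      ∫ t in a..b, M * (b - a) * ‖D t‖ * ‖v.snd‖ := by
    rw [intervalIntegral.integral_mul_const, intervalIntegral.integral_const_mul]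
  rw [hR]
  refine intervalIntegral.norm_integral_le_of_norm_le hab.le ?_
    ((hDab.norm.const_mul _).mul_const _)
  filter_upwards [hae] with t ht htab
  have htT : t ∈ Ioc 0 T := ⟨lt_of_le_of_lt ha htab.1, htab.2.trans hb⟩
  rw [← ht htab, hA, add_sub_add_left_eq_sub, Real.norm_eq_abs]
  have hMba : 0 ≤ M * (b - a) := mul_nonneg hM0 (sub_nonneg.mpr hab.le)
  -- Only the lower-order part of the form depends on time, so freezing it costs `M(b - t) ≤ M(b -
  -- a)` by the Lipschitz bound.
  refine abs_fpForm_sub_le (hFm b hbT) (hFM b hbT) (hFm t htT) (hFM t htT)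
    (fun x hx => (hFL b hbT t htT x hx).trans ?_) hMba (D t) v
  refine mul_le_mul_of_nonneg_left ?_ hM0
  rw [abs_sub_comm, abs_of_nonneg (sub_nonneg.mpr htab.2)]
  linarith [htab.1]

end IsWeakSolution

end FracFP

/-! ### Stability of the scheme and the error bound -/

namespace FracFP

lemma map_seqConv {V W : Type*} [NormedAddCommGroup V] [InnerProductSpace ℝ V]
    [NormedAddCommGroup W] [InnerProductSpace ℝ W] (A : V →ₗ[ℝ] W) (a : ℕ → ℝ) (x : ℕ → V) (n : ℕ) :
    A (seqConv a x n) = seqConv a (fun j => A (x j)) n := by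
  simp [seqConv, map_sum]

/-- The increments of the fractional integral of a step function starting from zero are the
discrete convolution of the weights with the increments of the function. -/
lemma fracInt_check_succ_sub {V : Type*} [NormedAddCommGroup V] [InnerProductSpace ℝ V]
    [CompleteSpace V] {α k : ℝ} (hα : 0 < α) (hk : 0 < k) {e : ℕ → V} (he : e 0 = 0) (n : ℕ) :
    fracInt α (check k e) ((n + 1 : ℕ) * k) - fracInt α (check k e) (n * k) =
      seqConv (stepWeight α k) (fun j => e (j + 1) - e j) n := by
  have h1 : ∀ m : ℕ, fracInt α (check k e) (m * k) =
      ∑ j ∈ Finset.range m, seqConv (stepWeight α k) (fun j => e (j + 1) - e j) j := by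
    intro m
    rw [fracInt_check_grid hα hk]
    rcases m with _ | m
    · simp
    -- Summation commutes with convolution by the weights, and the sum of the increments telescopes
    -- to `e` because `e 0 = 0`.
    · rw [← seqConv_one (seqConv _ _), seqConv_assoc, seqConv_comm, ← seqConv_assoc]
      refine Finset.sum_congr rfl fun j _ => ?_
      rw [seqConv_one, Finset.sum_range_sub, he, sub_zero]
      rfl
  rw [h1, h1, Finset.sum_range_succ, add_sub_cancel_left]

variable {L α T k : ℝ} {F : ℝ → ℝ → ℝ} {g : ℝ → L2 L} {u₀ : Pair L} {u ut : ℝ → Pair L} {N : ℕ}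
  {gbar : ℕ → L2 L} {U : ℕ → Pair L}

/-- In the scheme the forcing is constant on each cell, so the time integral goes inside the form
and `fracDeriv_check` evaluates it. -/
lemma IsScheme.equation_succ (h : IsScheme α L k N F gbar u₀ U) (hα : 0 < α) (hk : 0 < k) {M : ℝ}
    (hF : ForcingBound L (N * k) M F) {n : ℕ} (hn : n < N) {v : Pair L} (hv : v ∈ H10 L) :
    inner ℝ (U (n + 1) - U n).fst v.fst + fpForm (fun x => F x ((n + 1 : ℕ) * k))
      (fracInt α (check k U) ((n + 1 : ℕ) * k) - fracInt α (check k U) (n * k)) v =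
      k * inner ℝ (gbar (n + 1)) v.fst := by
  have ht : ((n + 1 : ℕ) : ℝ) * k ∈ Ioc 0 (N * k) := by
    refine ⟨by positivity, mul_le_mul_of_nonneg_right ?_ hk.le⟩
    exact_mod_cast hn
  have h1 := h.equation (n + 1) (by simp; omega) v hv
  have h2 : (((n + 1 : ℕ) : ℝ) - 1) * k = n * k := by
    push_cast
    ring
  rw [h2, Nat.add_sub_cancel] at h1
  obtain ⟨A, hA⟩ := exists_fpForm_clm (hF.2.1 _ ht) (hF.2.2.1 _ ht) hF.1 v
  have h3 := fracDeriv_check hα hk U n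
  rw [← h1, ← h3.2, ← hA, ← ContinuousLinearMap.intervalIntegral_comp_comm A h3.1]
  simp_rw [hA]

set_option maxHeartbeats 400000 in
/-- The energy inequality for the error in one step. -/
lemma inner_error_increment_le (hα : 0 < α) (hα' : α ≤ 1) (hk : 0 < k) (hNk : N * k = T) {M : ℝ}
    (hF : ForcingBound L T M F) (hu : IsWeakSolution α L T F g u₀ u ut)
    (hU : IsScheme α L k N F gbar u₀ U) {n : ℕ} (hn : n < N) :
    2 * inner ℝ ((U (n + 1) - u ((n + 1 : ℕ) * k)) - (U n - u (n * k))).fst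
      (seqConv (stepWeight α k)
        (fun j => (U (j + 1) - u ((j + 1 : ℕ) * k)) - (U j - u (j * k))) n).fst ≤
      (2 * M ^ 2 + 1) * ‖(seqConv (stepWeight α k)
        (fun j => (U (j + 1) - u ((j + 1 : ℕ) * k)) - (U j - u (j * k))) n).fst‖ ^ 2 +
      (2 * (1 + M) ^ 2 * seqConv (stepDiff α k)
          (fun j => ∫ s in (j * k : ℝ)..((j + 1 : ℕ) * k), ‖ut s‖) n ^ 2 +
        2 * M ^ 2 * k ^ 2 *
          (∫ t in (n * k : ℝ)..((n + 1 : ℕ) * k), ‖fracDerivAC α u₀ ut t‖) ^ 2 +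
        (∫ t in (n * k : ℝ)..((n + 1 : ℕ) * k), ‖gbar (n + 1) - g t‖) ^ 2) := by
  have hT : 0 ≤ T := by
    rw [← hNk]
    positivity
  set e : ℕ → Pair L := fun j => U j - u (j * k) with he
  set w := seqConv (stepWeight α k) (fun j => e (j + 1) - e j) with hw
  set r := seqConv (stepDiff α k)
    (fun j => ∫ s in (j * k : ℝ)..((j + 1 : ℕ) * k), ‖ut s‖) n with hr
  set P := ∫ t in (n * k : ℝ)..((n + 1 : ℕ) * k), ‖fracDerivAC α u₀ ut t‖ with hP
  set G := ∫ t in (n * k : ℝ)..((n + 1 : ℕ) * k), ‖gbar (n + 1) - g t‖ with hG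
  have hgrid : ∀ j ≤ N, (j : ℝ) * k ∈ Icc 0 T := fun j hj => by
    rw [← hNk]
    exact ⟨by positivity, mul_le_mul_of_nonneg_right (by exact_mod_cast hj) hk.le⟩
  have hu0 : u 0 = u₀ := by
    rw [hu.eq_integral 0 ⟨le_rfl, hT⟩]
    simp
  have he0 : e 0 = 0 := by simp [he, hU.initial, hu0]
  have heH : ∀ j ≤ N, e j ∈ H10 L := by
    intro j hj
    rcases Nat.eq_zero_or_pos j with h0 | h0
    · rw [h0, he0]
      exact Submodule.zero_mem _
    · exact Submodule.sub_mem _ (hU.mem_H10 j (by simp; omega)) (hu.mem_H10 _ (hgrid j hj))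
  have hwH : w n ∈ H10 L := by
    refine Submodule.sum_mem _ fun j hj => Submodule.smul_mem _ _ ?_
    have := Finset.mem_range.mp hj
    exact Submodule.sub_mem _ (heH _ (by omega)) (heH _ (by omega))
  have hlt : (n : ℝ) * k < (n + 1 : ℕ) * k := by
    push_cast
    nlinarith
  have hend := hgrid (n + 1) hn
  have hlen : ((n + 1 : ℕ) : ℝ) * k - n * k = k := by
    push_cast
    ring
  have hpos : 0 < ((n + 1 : ℕ) : ℝ) * k := by positivity
  have eq1 := hU.equation_succ hα hk (hNk.symm ▸ hF) hn hwH
  have eq2 := hu.abs_integral_equation_le hα hF (hgrid n hn.le).1 hlt hend.2 hwH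
  rw [hlen, ← hP] at eq2
  obtain ⟨hM0, hFm, hFM, -⟩ := hF
  have htI : ((n + 1 : ℕ) : ℝ) * k ∈ Ioc 0 T := ⟨hpos, hend.2⟩
  have hsub : uIcc ((n : ℝ) * k) ((n + 1 : ℕ) * k) ⊆ uIcc 0 T := by
    rw [uIcc_of_le hlt.le, uIcc_of_le hT]
    exact Icc_subset_Icc (hgrid n hn.le).1 hend.2
  have hgi := (hu.intervalIntegrable_source hT).mono_set hsub
  set R := (fracInt α u ((n + 1 : ℕ) * k) - fracInt α u (n * k)) -
      (fracInt α (check k fun j => u (j * k)) ((n + 1 : ℕ) * k) -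
        fracInt α (check k fun j => u (j * k)) (n * k)) with hR
  have hRle : ‖R‖ ≤ r := norm_fracInt_sub_check_le hα hα' hk (hu.intervalIntegrable_deriv hT) hT
    hu.eq_integral hend.2
  -- The scheme sees the test function `w n`, minus the interpolation defect `R`, plus the exact
  -- increment, which the integrated weak equation controls.
  have hsplit : fracInt α (check k U) ((n + 1 : ℕ) * k) - fracInt α (check k U) (n * k) =
      (w n - R) + (fracInt α u ((n + 1 : ℕ) * k) - fracInt α u (n * k)) := by
    have h1 : ∀ m : ℕ, fracInt α (check k e) (m * k) = fracInt α (check k U) (m * k) -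
        fracInt α (check k fun j => u (j * k)) (m * k) := by
      intro m
      rw [fracInt_check_grid hα hk, fracInt_check_grid hα hk, fracInt_check_grid hα hk,
        ← Finset.sum_sub_distrib]
      exact Finset.sum_congr rfl fun j _ => smul_sub _ _ _
    rw [hw, ← fracInt_check_succ_sub hα hk he0, h1, h1, hR]
    abel
  obtain ⟨A, hA⟩ := exists_fpForm_clm (hFm _ htI) (hFM _ htI) hM0 (w n)
  have hgbar : k * inner ℝ (gbar (n + 1)) (w n).fst -
      ∫ t in (n * k : ℝ)..((n + 1 : ℕ) * k), inner ℝ (g t) (w n).fst ≤ G * ‖(w n).fst‖ := by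
    have hgi2 : IntervalIntegrable (fun t => gbar (n + 1) - g t) volume
        (n * k) ((n + 1 : ℕ) * k) := (by simp : IntervalIntegrable (fun _ => gbar (n + 1))
          volume _ _).sub hgi
    have iG : IntervalIntegrable (fun t => inner ℝ (g t) (w n).fst) volume
        (n * k) ((n + 1 : ℕ) * k) := ⟨hgi.1.inner_const _, hgi.2.inner_const _⟩
    have h1 : k * inner ℝ (gbar (n + 1)) (w n).fst = ∫ t in (n * k : ℝ)..((n + 1 : ℕ) * k),
        inner ℝ (gbar (n + 1)) (w n).fst := by
      rw [intervalIntegral.integral_const, hlen, smul_eq_mul]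
    rw [h1, ← intervalIntegral.integral_sub (by simp) iG, hG,
      ← intervalIntegral.integral_mul_const]
    refine intervalIntegral.integral_mono_on hlt.le ((by simp : IntervalIntegrable
      (fun _ => inner ℝ (gbar (n + 1)) (w n).fst) volume _ _).sub iG)
      (hgi2.norm.mul_const _) fun t _ => ?_
    rw [← inner_sub_left]
    exact real_inner_le_norm _ _
  have hform1 := le_fpForm_self (hFm _ htI) (hFM _ htI) (w n)
  have hform2 := (abs_le.mp (abs_fpForm_le (hFm _ htI) (hFM _ htI) hM0 R (w n))).2
  have hRw : (1 + M) * ‖R‖ * ‖(w n).snd‖ ≤ (1 + M) * r * ‖(w n).snd‖ := by gcongr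
  have eq3 := (abs_le.mp eq2).1
  rw [hsplit, ← hA, map_add, map_sub, hA, hA, hA] at eq1
  have hinner : inner ℝ (e (n + 1) - e n).fst (w n).fst =
      inner ℝ (U (n + 1) - U n).fst (w n).fst -
        inner ℝ (u ((n + 1 : ℕ) * k) - u (n * k)).fst (w n).fst := by
    rw [← inner_sub_left, ← WithLp.sub_fst]
    congr 2
    simp only [he]
    abel
  have key : inner ℝ (e (n + 1) - e n).fst (w n).fst + ‖(w n).snd‖ ^ 2 ≤
      (M * ‖(w n).fst‖ + (1 + M) * r + M * k * P) * ‖(w n).snd‖ + G * ‖(w n).fst‖ := by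
    rw [hinner]
    linarith
  set X := inner ℝ (e (n + 1) - e n).fst (w n).fst with hX
  set a := ‖(w n).fst‖ with ha
  set b := ‖(w n).snd‖ with hb
  -- Young's inequality: with `s` the sum of the three terms multiplying `b`, `2sb - 2b² ≤ s²/2`,
  -- and `s²` is at most three times the sum of the squares. The source term uses `2Ga ≤ G² + a²`,
  -- whence the coefficient `2M² + 1`.
  have q1 := sq_nonneg (M * a + (1 + M) * r + M * k * P - 2 * b)
  have q2 := sq_nonneg (M * a - (1 + M) * r)
  have q3 := sq_nonneg (M * a - M * k * P)
  have q4 := sq_nonneg ((1 + M) * r - M * k * P)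
  have q5 := sq_nonneg (G - a)
  linarith [sq_nonneg (M * a), sq_nonneg ((1 + M) * r), sq_nonneg (M * k * P)]

lemma sum_integral_grid {f : ℝ → ℝ} (hk : 0 < k) {m : ℕ}
    (hf : IntervalIntegrable f volume 0 (m * k)) :
    ∑ j ∈ Finset.range m, ∫ s in (j * k : ℝ)..((j + 1 : ℕ) * k), f s =
      ∫ s in (0 : ℝ)..(m * k), f s := by
  have h := intervalIntegral.sum_integral_adjacent_intervals (n := m) (μ := volume) (f := f)
    (a := fun j : ℕ => (j : ℝ) * k) (fun j hj => ?_)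
  · simpa using h
  · refine hf.mono_set ?_
    rw [uIcc_of_le (by push_cast; nlinarith), uIcc_of_le (by positivity)]
    refine Icc_subset_Icc (by positivity) (mul_le_mul_of_nonneg_right ?_ hk.le)
    exact_mod_cast hj

set_option maxHeartbeats 400000 in
/-- The error bound for square-integrable `ḡʲ - g`. -/
theorem exists_norm_error_sq_le (L : ℝ) (hα : 1 / 2 < α) (hα' : α ≤ 1) (hT : 0 < T)
    {M : ℝ} (hF : ForcingBound L T M F) :
    ∃ C k₀ : ℝ, 0 < C ∧ 0 < k₀ ∧ k₀ ≤ 1 ∧ ∀ (g : ℝ → L2 L) (u₀ : Pair L) (u ut : ℝ → Pair L),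
      IsWeakSolution α L T F g u₀ u ut → ∀ (N : ℕ) (k : ℝ), 0 < N → k = T / N → k ≤ k₀ →
      ∀ (gbar : ℕ → L2 L) (U : ℕ → Pair L), IsScheme α L k N F gbar u₀ U → ∀ n ≤ N,
      (∀ j < n, IntervalIntegrable (fun t => ‖gbar (j + 1) - g t‖ ^ 2) volume
        (j * k) ((j + 1 : ℕ) * k)) →
      ‖(U n - u (n * k)).fst‖ ^ 2 ≤ C * (∑ j ∈ Finset.range n,
        ∫ t in (j * k : ℝ)..((j + 1 : ℕ) * k), ‖gbar (j + 1) - g t‖ ^ 2) +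
        C * k ^ 2 * ‖u₀‖ ^ 2 + C * k ^ (2 * α) * ∫ t in (0 : ℝ)..(n * k), ‖ut t‖ ^ 2 := by
  have hα0 : 0 < α := by linarith
  set c := 2 * M ^ 2 + 1 with hc
  have hc0 : 0 < c := by positivity
  -- Chosen so that `c · e · μ^(-α) = 1/2`, the smallness needed for the Gronwall kernel once `μk ≤
  -- 1`.
  set μ := (2 * c * Real.exp 1) ^ (1 / α) with hμ
  have hbase : 0 < 2 * c * Real.exp 1 := by positivity
  have hμ0 : 0 < μ := Real.rpow_pos_of_pos hbase _
  have hμα : (1 / μ) ^ α = 1 / (2 * c * Real.exp 1) := by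
    rw [Real.div_rpow zero_le_one hμ0.le, Real.one_rpow, hμ, ← Real.rpow_mul hbase.le,
      one_div_mul_cancel hα0.ne', Real.rpow_one]
  set Q := ∫ s in (0 : ℝ)..T, omega α s ^ 2 with hQ
  have hQ0 : 0 ≤ Q := intervalIntegral.integral_nonneg hT.le fun s _ => sq_nonneg _
  set Γ := Real.Gamma (α + 1) with hΓ
  have hΓ0 : 0 < Γ := Real.Gamma_pos_of_pos (by linarith)
  have hωT := omega_pos hα0 hT
  set S := 2 * Real.exp (μ * T) / omega α T with hS
  have hS0 : 0 < S := by positivity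
  obtain ⟨hM0, -⟩ := id hF
  -- `S / k` bounds the stability factor; the three summands come from interpolation, from freezing
  -- `F` and from the source. The condition `k ≤ 1/μ` bounds `exp(μk)` by `e`, and `k ≤ 1` gives `k²
  -- ≤ k^(2α)`.
  refine ⟨S * (8 * (1 + M) ^ 2 / Γ ^ 2 + 4 * M ^ 2 * Q * (1 + T) + 1), min 1 (1 / μ),
    by positivity, by positivity, min_le_left _ _, ?_⟩
  intro g u₀ u ut hu N k hN hkN hk0 gbar U hU n hn hGi
  have hN' : (0 : ℝ) < N := by exact_mod_cast hN
  have hk : 0 < k := by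
    rw [hkN]
    positivity
  have hNk : N * k = T := by
    rw [hkN]
    field_simp
  have hk1 : k ≤ 1 := hk0.trans (min_le_left _ _)
  have hkμ : μ * k ≤ 1 := by
    have := hk0.trans (min_le_right _ _)
    rwa [le_div_iff₀ hμ0, mul_comm] at this
  have hu0 : u 0 = u₀ := by
    rw [hu.eq_integral 0 ⟨le_rfl, hT.le⟩]
    simp
  rcases n with _ | m
  · simp only [Nat.cast_zero, zero_mul, Finset.range_zero, Finset.sum_empty, mul_zero, zero_add,
      intervalIntegral.integral_same, add_zero, hU.initial, hu0, sub_self, WithLp.zero_fst,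
      norm_zero, ne_eq, OfNat.ofNat_ne_zero, not_false_eq_true, zero_pow]
    positivity
  have hmT : ((m + 1 : ℕ) : ℝ) * k ∈ Icc 0 T := by
    rw [← hNk]
    exact ⟨by positivity, mul_le_mul_of_nonneg_right (by exact_mod_cast hn) hk.le⟩
  have hsubT : uIcc 0 (((m + 1 : ℕ) : ℝ) * k) ⊆ uIcc 0 T := by
    rw [uIcc_of_le hmT.1, uIcc_of_le hT.le]
    exact Icc_subset_Icc_right hmT.2
  have hcell : ∀ j < m + 1, uIcc ((j : ℝ) * k) ((j + 1 : ℕ) * k) ⊆ uIcc 0 T := by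
    intro j hj
    rw [uIcc_of_le (by push_cast; nlinarith), uIcc_of_le hT.le, ← hNk]
    refine Icc_subset_Icc (by positivity) (mul_le_mul_of_nonneg_right ?_ hk.le)
    exact_mod_cast (by omega : j + 1 ≤ N)
  have hlen : ∀ j : ℕ, ((j + 1 : ℕ) : ℝ) * k - j * k = k := fun j => by
    push_cast
    ring
  have hle : ∀ j : ℕ, (j : ℝ) * k ≤ (j + 1 : ℕ) * k := fun j => by linarith [hlen j]
  have hut := hu.intervalIntegrable_deriv hT.le
  have hut2 := hu.intervalIntegrable_deriv_sq hT.le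
  have hD := intervalIntegrable_fracDerivAC hα0 u₀ hut hT.le
  obtain ⟨hD2, hDle⟩ := integral_norm_fracDerivAC_sq_le hα hT.le u₀ hut hut2
  have hg := hu.intervalIntegrable_source hT.le
  set A := ∫ t in (0 : ℝ)..((m + 1 : ℕ) * k), ‖ut t‖ ^ 2 with hA
  have hA0 : 0 ≤ A := intervalIntegral.integral_nonneg hmT.1 fun t _ => sq_nonneg _
  set a := stepWeight α k with ha
  set x : ℕ → Pair L := fun j => (U (j + 1) - u ((j + 1 : ℕ) * k)) - (U j - u (j * k)) with hx
  set δ : ℕ → ℝ := fun j => ∫ s in (j * k : ℝ)..((j + 1 : ℕ) * k), ‖ut s‖ with hδ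
  set d : ℕ → ℝ := fun n => 2 * (1 + M) ^ 2 * seqConv (stepDiff α k) δ n ^ 2 +
        2 * M ^ 2 * k ^ 2 *
          (∫ t in (n * k : ℝ)..((n + 1 : ℕ) * k), ‖fracDerivAC α u₀ ut t‖) ^ 2 +
        (∫ t in (n * k : ℝ)..((n + 1 : ℕ) * k), ‖gbar (n + 1) - g t‖) ^ 2 with hd
  set ρ := Real.exp (-(μ * k)) with hρ
  have hρ1 : ρ ≤ 1 := Real.exp_le_one_iff.mpr (neg_nonpos.mpr (by positivity))
  have hsmall : c * ∑ i ∈ Finset.range (m + 1), a i * ρ ^ i ≤ 1 / 2 := by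
    have h1 := sum_stepWeight_mul_exp_le hα0 hk hμ0 (m + 1)
    rw [hμα] at h1
    have h2 : Real.exp (μ * k) ≤ Real.exp 1 := Real.exp_le_exp.mpr hkμ
    calc _ ≤ c * (Real.exp (μ * k) * (1 / (2 * c * Real.exp 1))) :=
          mul_le_mul_of_nonneg_left h1 hc0.le
      _ ≤ c * (Real.exp 1 * (1 / (2 * c * Real.exp 1))) := by gcongr
      _ = 1 / 2 := by
          have := (Real.exp_pos 1).ne'
          field_simp
  have hfst : ∀ j, (seqConv a x j).fst = seqConv a (fun i => (x i).fst) j := fun j =>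
    map_seqConv (WithLp.fstₗ 2 ℝ (L2 L) (L2 L)) a x j
  have main := norm_sum_sq_le_of_inner_seqConv_le (stepWeight_pos hα0 hα' hk)
    (stepWeight_antitone hα0 hα' hk) (stepWeight_logConvex hα0 hα' hk) (fun i => (x i).fst)
    hc0.le (Real.exp_pos _) hρ1 d (fun n => by positivity) m hsmall (fun j hj => by
      have := inner_error_increment_le hα0 hα' hk hNk hF hu hU (show j < N by omega)
      rw [← hfst]
      exact this)
  have hsum : ∑ i ∈ Finset.range (m + 1), (x i).fst = (U (m + 1) - u ((m + 1 : ℕ) * k)).fst := by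
    have h1 := Finset.sum_range_sub (fun j => (U j - u (j * k)).fst) (m + 1)
    have h2 : (U 0 - u ((0 : ℕ) * k)).fst = 0 := by simp [hU.initial, hu0]
    rw [h2, sub_zero] at h1
    rw [← h1]
    exact Finset.sum_congr rfl fun j _ => WithLp.sub_fst _ _
  rw [hsum] at main
  refine main.trans ?_
  -- Since `ω_α` decreases, `a m ≥ k ω_α(T)`; the exponential weight costs at most `exp(μT)`.
  have hcoef : 2 / (a m * ρ ^ m) ≤ S / k := by
    have h1 : k * omega α T ≤ a m := by
      refine le_trans ?_ (mul_omega_le_stepWeight hα0 hα' hk m)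
      refine mul_le_mul_of_nonneg_left (omega_anti hα0 hα' (by positivity) ?_) hk.le
      simpa using hmT.2
    have h2 : Real.exp (-(μ * T)) ≤ ρ ^ m := by
      rw [hρ, ← Real.exp_nat_mul]
      refine Real.exp_le_exp.mpr ?_
      have h3 : (m : ℝ) * k ≤ T := (hle m).trans hmT.2
      nlinarith
    have h3 : k * omega α T * Real.exp (-(μ * T)) ≤ a m * ρ ^ m :=
      mul_le_mul h1 h2 (Real.exp_pos _).le (stepWeight_pos hα0 hα' hk m).le
    have h4 : S / k = 2 / (k * omega α T * Real.exp (-(μ * T))) := by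
      rw [hS, Real.exp_neg]
      have := (Real.exp_pos (μ * T)).ne'
      field_simp
    rw [h4]
    exact div_le_div_of_nonneg_left (by norm_num) (by positivity) h3
  -- Young's convolution inequality contributes the squared mass `O(k^(2α))`, and Cauchy–Schwarz on
  -- each cell contributes the factor `k`.
  have hsumr : ∑ j ∈ Finset.range (m + 1), seqConv (stepDiff α k) δ j ^ 2 ≤
      k * (4 / Γ ^ 2 * k ^ (2 * α) * A) := by
    refine (sum_seqConv_sq_le (stepDiff_nonneg hα0 hα' hk) (m + 1)).trans ?_
    have h1 : (∑ i ∈ Finset.range (m + 1), stepDiff α k i) ^ 2 ≤ 4 / Γ ^ 2 * k ^ (2 * α) := by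
      have h2 := pow_le_pow_left₀ (Finset.sum_nonneg fun i _ => stepDiff_nonneg hα0 hα' hk i)
        (sum_stepDiff_le hα0 hα' hk (m + 1)) 2
      refine h2.trans (le_of_eq ?_)
      have h3 : k ^ (2 * α) = (k ^ α) ^ 2 := by
        rw [mul_comm, Real.rpow_mul hk.le, Real.rpow_two]
      rw [omega, h3, add_sub_cancel_right]
      ring
    have h4 : ∑ j ∈ Finset.range (m + 1), δ j ^ 2 ≤ k * A := by
      rw [hA, ← sum_integral_grid hk (hut2.mono_set hsubT), Finset.mul_sum]
      refine Finset.sum_le_sum fun j hj => ?_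
      have hj' := Finset.mem_range.mp hj
      have := sq_integral_norm_le (hle j) (hut.mono_set (hcell j hj'))
        (hut2.mono_set (hcell j hj'))
      rwa [hlen] at this
    calc _ ≤ (4 / Γ ^ 2 * k ^ (2 * α)) * (k * A) :=
          mul_le_mul h1 h4 (Finset.sum_nonneg fun j _ => sq_nonneg _) (by positivity)
      _ = _ := by ring
  have hsumD : ∑ j ∈ Finset.range (m + 1),
      (∫ t in (j * k : ℝ)..((j + 1 : ℕ) * k), ‖fracDerivAC α u₀ ut t‖) ^ 2 ≤
      k * (2 * Q * (‖u₀‖ ^ 2 + T * A)) := by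
    refine le_trans ?_ (mul_le_mul_of_nonneg_left (hDle _ hmT) hk.le)
    rw [← sum_integral_grid hk (hD2.mono_set hsubT), Finset.mul_sum]
    refine Finset.sum_le_sum fun j hj => ?_
    have hj' := Finset.mem_range.mp hj
    have := sq_integral_norm_le (hle j) (hD.mono_set (hcell j hj')) (hD2.mono_set (hcell j hj'))
    rwa [hlen] at this
  set H := ∑ j ∈ Finset.range (m + 1),
    ∫ t in (j * k : ℝ)..((j + 1 : ℕ) * k), ‖gbar (j + 1) - g t‖ ^ 2 with hH
  have hH0 : 0 ≤ H := Finset.sum_nonneg fun j _ =>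
    intervalIntegral.integral_nonneg (hle j) fun t _ => sq_nonneg _
  have hsumG : ∑ j ∈ Finset.range (m + 1),
      (∫ t in (j * k : ℝ)..((j + 1 : ℕ) * k), ‖gbar (j + 1) - g t‖) ^ 2 ≤ k * H := by
    rw [hH, Finset.mul_sum]
    refine Finset.sum_le_sum fun j hj => ?_
    have hj' := Finset.mem_range.mp hj
    have hi : IntervalIntegrable (fun t => gbar (j + 1) - g t) volume (j * k) ((j + 1 : ℕ) * k) :=
      (by simp : IntervalIntegrable (fun _ => gbar (j + 1)) volume _ _).sub
        (hg.mono_set (hcell j hj'))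
    have := sq_integral_norm_le (hle j) hi (hGi j hj')
    rwa [hlen] at this
  have hdsum : ∑ j ∈ Finset.range (m + 1), d j ≤ k * (8 * (1 + M) ^ 2 / Γ ^ 2 * k ^ (2 * α) * A +
      4 * M ^ 2 * Q * k ^ 2 * (‖u₀‖ ^ 2 + T * A) + H) := by
    simp only [hd]
    rw [Finset.sum_add_distrib, Finset.sum_add_distrib, ← Finset.mul_sum, ← Finset.mul_sum]
    have h1 := mul_le_mul_of_nonneg_left hsumr (show 0 ≤ 2 * (1 + M) ^ 2 by positivity)
    have h2 := mul_le_mul_of_nonneg_left hsumD (show 0 ≤ 2 * M ^ 2 * k ^ 2 by positivity)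
    calc _ ≤ 2 * (1 + M) ^ 2 * (k * (4 / Γ ^ 2 * k ^ (2 * α) * A)) +
          2 * M ^ 2 * k ^ 2 * (k * (2 * Q * (‖u₀‖ ^ 2 + T * A))) + k * H :=
          add_le_add (add_le_add h1 h2) hsumG
      _ = _ := by ring
  have hd0 : 0 ≤ ∑ j ∈ Finset.range (m + 1), d j := Finset.sum_nonneg fun j _ => by positivity
  have hkk : k ^ 2 ≤ k ^ (2 * α) := by
    rw [← Real.rpow_two]
    exact Real.rpow_le_rpow_of_exponent_ge hk hk1 (by linarith)
  set κ := k ^ (2 * α) with hκ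
  have hκ0 : 0 ≤ κ := by positivity
  set Z := 8 * (1 + M) ^ 2 / Γ ^ 2 with hZ
  have hZ0 : 0 ≤ Z := by positivity
  set Y := 4 * M ^ 2 * Q with hY
  have hY0 : 0 ≤ Y := by positivity
  calc _ ≤ S / k * (k * (Z * κ * A + Y * k ^ 2 * (‖u₀‖ ^ 2 + T * A) + H)) :=
        mul_le_mul hcoef hdsum hd0 (by positivity)
    _ = S * (Z * κ * A + Y * k ^ 2 * (‖u₀‖ ^ 2 + T * A) + H) := by
        field_simp
    _ ≤ S * ((Z + Y * (1 + T) + 1) * H + (Z + Y * (1 + T) + 1) * (k ^ 2 * ‖u₀‖ ^ 2) +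
          (Z + Y * (1 + T) + 1) * (κ * A)) := by
        refine mul_le_mul_of_nonneg_left ?_ hS0.le
        have h1 : Y * T * (k ^ 2 * A) ≤ Y * T * (κ * A) := by gcongr
        have h2 : 0 ≤ k ^ 2 * ‖u₀‖ ^ 2 := by positivity
        have h3 : 0 ≤ κ * A := by positivity
        have h4 : 0 ≤ Y * T := by positivity
        linarith [mul_nonneg hZ0 hH0, mul_nonneg hY0 hH0, mul_nonneg h4 hH0, mul_nonneg hZ0 h2,
          mul_nonneg h4 h2, mul_nonneg hY0 h3]
    _ = _ := by ring

/-! ### Bounds in terms of lower integrals -/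

section LIntegral

variable {V : Type*} [NormedAddCommGroup V]

lemma ofReal_norm_sq (x : V) : ENNReal.ofReal (‖x‖ ^ 2) = ‖x‖ₑ ^ 2 := by
  rw [ENNReal.ofReal_pow (norm_nonneg _), ofReal_norm]

lemma ofReal_integral_norm_sq {v : ℝ → V} {a b : ℝ} (hab : a ≤ b)
    (hv : IntervalIntegrable (fun t => ‖v t‖ ^ 2) volume a b) :
    ENNReal.ofReal (∫ t in a..b, ‖v t‖ ^ 2) = ∫⁻ t in Ioo a b, ‖v t‖ₑ ^ 2 := by
  rw [intervalIntegrable_iff_integrableOn_Ioo_of_le hab] at hv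
  rw [intervalIntegral.integral_of_le hab, integral_Ioc_eq_integral_Ioo,
    ofReal_integral_eq_lintegral_ofReal hv (Filter.Eventually.of_forall fun t => sq_nonneg _)]
  simp_rw [ofReal_norm_sq]

lemma intervalIntegrable_norm_sq_of_lintegral_lt_top {v : ℝ → V} {a b : ℝ} (hab : a ≤ b)
    (hv : IntervalIntegrable v volume a b) (h : ∫⁻ t in Ioo a b, ‖v t‖ₑ ^ 2 < ⊤) :
    IntervalIntegrable (fun t => ‖v t‖ ^ 2) volume a b := by
  rw [intervalIntegrable_iff_integrableOn_Ioo_of_le hab] at hv ⊢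
  refine ⟨hv.aestronglyMeasurable.norm.pow 2, ?_⟩
  rw [hasFiniteIntegral_iff_ofReal (Filter.Eventually.of_forall fun t => sq_nonneg _)]
  simpa only [ofReal_norm_sq] using h

end LIntegral

end FracFP

/-! ### The extended-valued error bound and the convergence rate. -/

theorem theorem4p4 (α L T : ℝ) (hα : 1 / 2 < α) (hα' : α ≤ 1) (hL : 0 < L) (hT : 0 < T)
    (F : ℝ → ℝ → ℝ) (hF : FracFP.BddInW1Infty L T F) (hFt : FracFP.LipschitzInTime L T F) :
    ∃ (C : ℝ≥0) (k₀ : ℝ), 0 < k₀ ∧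
      ∀ (g : ℝ → FracFP.L2 L) (u₀ : FracFP.Pair L) (u ut : ℝ → FracFP.Pair L),
        FracFP.IsWeakSolution α L T F g u₀ u ut →
        -- the error bound
        (∀ (N : ℕ) (k : ℝ), 0 < N → k = T / N → k ≤ k₀ →
          ∀ (gbar : ℕ → FracFP.L2 L) (U : ℕ → FracFP.Pair L),
            FracFP.IsScheme α L k N F gbar u₀ U →
            ∀ n : ℕ, n ≤ N →
              ‖(U n - u (n * k)).fst‖ₑ ^ 2 ≤
                C * (∑ j ∈ Finset.Icc 1 n,
                      (∫⁻ t in Ioo (((j : ℝ) - 1) * k) ((j : ℝ) * k), ‖gbar j - g t‖ₑ ^ 2))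
                + C * ENNReal.ofReal (k ^ (2 * α - 1)) *
                    (∫⁻ t in Ioo 0 k, ENNReal.ofReal t * FracFP.h2Seminorm (ut t) ^ 2)
                + C * ENNReal.ofReal (k ^ (2 * α)) *
                    (∫⁻ t in Ioo k (n * k), FracFP.h2Seminorm (ut t) ^ 2)
                + C * ENNReal.ofReal (k ^ 2) * ‖u₀‖ₑ ^ 2
                + C * ENNReal.ofReal (k ^ (2 * α)) *
                    (∫⁻ t in Ioo 0 (n * k), ‖ut t‖ₑ ^ 2)) ∧
        -- convergence of order `α` for regular solutions
        ((∫⁻ t in Ioo 0 T, FracFP.h2Seminorm (ut t) ^ 2) < ⊤ →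
          ∀ K : ℝ, ∃ C' : ℝ, ∀ (N : ℕ) (k : ℝ), 0 < N → k = T / N → k ≤ k₀ →
            ∀ (gbar : ℕ → FracFP.L2 L) (U : ℕ → FracFP.Pair L),
              FracFP.IsScheme α L k N F gbar u₀ U →
              (∀ j ∈ Finset.Icc 1 N, ∀ᵐ t : ℝ,
                t ∈ Ioo (((j : ℝ) - 1) * k) ((j : ℝ) * k) → ‖gbar j - g t‖ ≤ K * k ^ α) →
              ∀ n : ℕ, n ≤ N → ‖(U n - u (n * k)).fst‖ ≤ C' * k ^ α) := by
  obtain ⟨M, hM⟩ := FracFP.exists_forcingBound hF hFt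
  obtain ⟨C, k₀, hC, hk₀, hk₁, main⟩ := FracFP.exists_norm_error_sq_le L hα hα' hT hM
  refine ⟨C.toNNReal, k₀, hk₀, fun g u₀ u ut hu => ⟨?_, ?_⟩⟩
  · intro N k hN hkN hkk gbar U hU n hn
    have hN' : (0 : ℝ) < N := by exact_mod_cast hN
    have hk : 0 < k := by
      rw [hkN]
      positivity
    have hNk : N * k = T := by
      rw [hkN]
      field_simp
    have hnT : (n : ℝ) * k ≤ T := by
      rw [← hNk]
      exact mul_le_mul_of_nonneg_right (by exact_mod_cast hn) hk.le
    have hle : ∀ j : ℕ, (j : ℝ) * k ≤ (j + 1 : ℕ) * k := fun j => by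
      push_cast
      nlinarith
    have hsum : (∑ j ∈ Finset.Icc 1 n,
        (∫⁻ t in Ioo (((j : ℝ) - 1) * k) ((j : ℝ) * k), ‖gbar j - g t‖ₑ ^ 2)) =
        ∑ j ∈ Finset.range n,
          ∫⁻ t in Ioo ((j : ℝ) * k) ((j + 1 : ℕ) * k), ‖gbar (j + 1) - g t‖ₑ ^ 2 := by
      rw [← Finset.Ico_add_one_right_eq_Icc, Finset.sum_Ico_eq_sum_range, Nat.add_sub_cancel]
      refine Finset.sum_congr rfl fun j _ => ?_
      have e : ((1 + j : ℕ) : ℝ) - 1 = j := by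
        push_cast
        ring
      rw [e, add_comm 1 j]
    have hCpos : (C.toNNReal : ℝ≥0∞) ≠ 0 := by simpa using hC
    rw [hsum]
    -- If a source integral is infinite, the right side is `⊤` because `C > 0`. Otherwise `‖ḡ - g‖²`
    -- is integrable on each cell and the lower integrals agree with the real integrals in `main`.
    by_cases hfin : ∀ j < n,
        ∫⁻ t in Ioo ((j : ℝ) * k) ((j + 1 : ℕ) * k), ‖gbar (j + 1) - g t‖ₑ ^ 2 < ⊤
    · have hGi : ∀ j < n, IntervalIntegrable (fun t => ‖gbar (j + 1) - g t‖ ^ 2) volume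
          (j * k) ((j + 1 : ℕ) * k) := by
        intro j hj
        refine FracFP.intervalIntegrable_norm_sq_of_lintegral_lt_top (hle j) ?_ (hfin j hj)
        refine (by simp : IntervalIntegrable (fun _ => gbar (j + 1)) volume _ _).sub
          ((hu.intervalIntegrable_source hT.le).mono_set ?_)
        rw [uIcc_of_le (hle j), uIcc_of_le hT.le]
        refine Icc_subset_Icc (by positivity) (le_trans ?_ hnT)
        exact mul_le_mul_of_nonneg_right (by exact_mod_cast hj) hk.le
      have hA : IntervalIntegrable (fun t => ‖ut t‖ ^ 2) volume 0 (n * k) := by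
        refine (hu.intervalIntegrable_deriv_sq hT.le).mono_set ?_
        rw [uIcc_of_le hT.le, uIcc_of_le (by positivity)]
        exact Icc_subset_Icc_right hnT
      have h1 := ENNReal.ofReal_le_ofReal (main g u₀ u ut hu N k hN hkN hkk gbar U hU n hn hGi)
      have i1 : ∀ j : ℕ, 0 ≤ ∫ t in (j * k : ℝ)..((j + 1 : ℕ) * k), ‖gbar (j + 1) - g t‖ ^ 2 :=
        fun j => intervalIntegral.integral_nonneg (hle j) fun t _ => sq_nonneg _
      have i2 : 0 ≤ ∫ t in (0 : ℝ)..(n * k), ‖ut t‖ ^ 2 :=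
        intervalIntegral.integral_nonneg (by positivity) fun t _ => sq_nonneg _
      have i3 : 0 ≤ ∑ j ∈ Finset.range n,
          ∫ t in (j * k : ℝ)..((j + 1 : ℕ) * k), ‖gbar (j + 1) - g t‖ ^ 2 :=
        Finset.sum_nonneg fun j _ => i1 j
      rw [FracFP.ofReal_norm_sq, ENNReal.ofReal_add (by positivity) (by positivity),
        ENNReal.ofReal_add (by positivity) (by positivity), ENNReal.ofReal_mul hC.le,
        ENNReal.ofReal_mul (by positivity), ENNReal.ofReal_mul hC.le,
        ENNReal.ofReal_mul (by positivity), ENNReal.ofReal_mul hC.le, FracFP.ofReal_norm_sq,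
        FracFP.ofReal_integral_norm_sq (by positivity) hA,
        ENNReal.ofReal_sum_of_nonneg fun j _ => i1 j] at h1
      have e1 : ∑ j ∈ Finset.range n, ENNReal.ofReal
          (∫ t in (j * k : ℝ)..((j + 1 : ℕ) * k), ‖gbar (j + 1) - g t‖ ^ 2) =
          ∑ j ∈ Finset.range n,
            ∫⁻ t in Ioo ((j : ℝ) * k) ((j + 1 : ℕ) * k), ‖gbar (j + 1) - g t‖ₑ ^ 2 :=
        Finset.sum_congr rfl fun j hj =>
          FracFP.ofReal_integral_norm_sq (hle j) (hGi j (Finset.mem_range.mp hj))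
      rw [e1] at h1
      refine h1.trans ?_
      -- The two `H²` integrals are nonnegative and only enlarge the bound: the interpolation defect
      -- is measured in `H¹` and paired with `wₓ`, so `‖u_t‖₁` alone controls it.
      gcongr ?_ + _ + _
      exact le_self_add.trans le_self_add
    · push Not at hfin
      obtain ⟨j, hj, hjt⟩ := hfin
      have htop : ∑ j ∈ Finset.range n,
          ∫⁻ t in Ioo ((j : ℝ) * k) ((j + 1 : ℕ) * k), ‖gbar (j + 1) - g t‖ₑ ^ 2 = ⊤ :=
        ENNReal.sum_eq_top.mpr ⟨j, Finset.mem_range.mpr hj, top_le_iff.mp hjt⟩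
      rw [htop, ENNReal.mul_top hCpos]
      simp
  · intro _ K
    set A := ∫ t in (0 : ℝ)..T, ‖ut t‖ ^ 2 with hA
    have hA0 : 0 ≤ A := intervalIntegral.integral_nonneg hT.le fun t _ => sq_nonneg _
    -- Each term of the bound carries `k^(2α)`: the source cells have total length at most `T` and
    -- contribute `T K² k^(2α)`, and `k² ≤ k^(2α)` handles the initial value.
    refine ⟨√(C * (T * K ^ 2 + ‖u₀‖ ^ 2 + A)), ?_⟩
    intro N k hN hkN hkk gbar U hU hK n hn
    have hN' : (0 : ℝ) < N := by exact_mod_cast hN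
    have hk : 0 < k := by
      rw [hkN]
      positivity
    have hNk : N * k = T := by
      rw [hkN]
      field_simp
    have hnT : (n : ℝ) * k ≤ T := by
      rw [← hNk]
      exact mul_le_mul_of_nonneg_right (by exact_mod_cast hn) hk.le
    have hlen : ∀ j : ℕ, ((j + 1 : ℕ) : ℝ) * k - j * k = k := fun j => by
      push_cast
      ring
    have hle : ∀ j : ℕ, (j : ℝ) * k ≤ (j + 1 : ℕ) * k := fun j => by linarith [hlen j]
    have hbd : ∀ j < n, ∀ᵐ t, t ∈ Ioo ((j : ℝ) * k) ((j + 1 : ℕ) * k) →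
        ‖gbar (j + 1) - g t‖ ^ 2 ≤ (K * k ^ α) ^ 2 := by
      intro j hj
      have h1 := hK (j + 1) (by simp; omega)
      rw [show ((j + 1 : ℕ) : ℝ) - 1 = j by push_cast; ring] at h1
      filter_upwards [h1] with t h2 ht
      exact pow_le_pow_left₀ (norm_nonneg _) (h2 ht) 2
    have hGi : ∀ j < n, IntervalIntegrable (fun t => ‖gbar (j + 1) - g t‖ ^ 2) volume
          (j * k) ((j + 1 : ℕ) * k) := by
      intro j hj
      have hi : IntervalIntegrable (fun t => gbar (j + 1) - g t) volume
          (j * k) ((j + 1 : ℕ) * k) := by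
        refine (by simp : IntervalIntegrable (fun _ => gbar (j + 1)) volume _ _).sub
          ((hu.intervalIntegrable_source hT.le).mono_set ?_)
        rw [uIcc_of_le (hle j), uIcc_of_le hT.le]
        refine Icc_subset_Icc (by positivity) (le_trans ?_ hnT)
        exact mul_le_mul_of_nonneg_right (by exact_mod_cast hj) hk.le
      rw [intervalIntegrable_iff_integrableOn_Ioo_of_le (hle j)] at hi ⊢
      refine Integrable.of_bound (hi.aestronglyMeasurable.norm.pow 2) ((K * k ^ α) ^ 2) ?_
      rw [ae_restrict_iff' measurableSet_Ioo]
      filter_upwards [hbd j hj] with t ht hmem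
      rw [Real.norm_of_nonneg (sq_nonneg _)]
      exact ht hmem
    have hsum : ∑ j ∈ Finset.range n,
        ∫ t in (j * k : ℝ)..((j + 1 : ℕ) * k), ‖gbar (j + 1) - g t‖ ^ 2 ≤
        T * (K * k ^ α) ^ 2 := by
      have h1 : ∀ j ∈ Finset.range n,
          ∫ t in (j * k : ℝ)..((j + 1 : ℕ) * k), ‖gbar (j + 1) - g t‖ ^ 2 ≤
          k * (K * k ^ α) ^ 2 := by
        intro j hj
        have h2 : ∫ _ in (j * k : ℝ)..((j + 1 : ℕ) * k), (K * k ^ α) ^ 2 = k * (K * k ^ α) ^ 2 := by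
          rw [intervalIntegral.integral_const, hlen, smul_eq_mul]
        rw [← h2]
        refine intervalIntegral.integral_mono_ae_restrict (hle j) (hGi j (Finset.mem_range.mp hj))
          (by simp) ?_
        rw [Filter.EventuallyLE, ← Measure.restrict_congr_set Ioo_ae_eq_Icc,
          ae_restrict_iff' measurableSet_Ioo]
        exact hbd j (Finset.mem_range.mp hj)
      refine (Finset.sum_le_sum h1).trans ?_
      rw [Finset.sum_const, Finset.card_range, nsmul_eq_mul, ← mul_assoc]
      exact mul_le_mul_of_nonneg_right hnT (sq_nonneg _)
    have hAn : ∫ t in (0 : ℝ)..(n * k), ‖ut t‖ ^ 2 ≤ A :=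
      intervalIntegral.integral_mono_interval le_rfl (by positivity) hnT
        (Filter.Eventually.of_forall fun t => sq_nonneg _) (hu.intervalIntegrable_deriv_sq hT.le)
    have h1 := main g u₀ u ut hu N k hN hkN hkk gbar U hU n hn hGi
    have hkα : k ^ (2 * α) = (k ^ α) ^ 2 := by
      rw [mul_comm, Real.rpow_mul hk.le, Real.rpow_two]
    have hk2 : k ^ 2 ≤ (k ^ α) ^ 2 := by
      rw [← hkα, ← Real.rpow_two]
      exact Real.rpow_le_rpow_of_exponent_ge hk (hkk.trans hk₁) (by linarith)
    refine le_of_sq_le_sq ?_ (by positivity)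
    rw [mul_pow, Real.sq_sqrt (by positivity)]
    calc _ ≤ _ := h1
      _ ≤ C * (T * (K * k ^ α) ^ 2) + C * (k ^ α) ^ 2 * ‖u₀‖ ^ 2 + C * (k ^ α) ^ 2 * A := by
          rw [hkα]
          gcongr
      _ = _ := by ring
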